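/- Let $X$ be a smooth finite-dimensional real manifold without boundary (compactness is not needed). For a smooth Riemannian metric $g$ on $X$ let $\nabla_g$ be its Levi-Civita connection; for a symmetric $2$-tensor $v$ put $v_g^{*}:=g^{-1}v$, that is, $g(v_g^{*}\xi,\eta)=v(\xi,\eta)$, and for an endomorphism $A$ of $T_X$ let $A_g^{T}=g^{-1}A^{*}g$ be its $g$-transpose. For a section $S$ of $\mathrm{End}_{\mathbb R}(T_X)$ write $\nabla_g S(\xi,\eta):=(\nabla_{g,\xi}S)\,\eta$ and, for an endomorphism section $J$, $$\nabla^{0,1}_{g,J}S(\xi,\eta):=\tfrac12\big[\nabla_gS(\xi,\eta)+J\,\nabla_gS(J\xi,\eta)\big],\qquad \nabla^{0,1}_{g,J}S\cdot\eta:=\nabla^{0,1}_{g,J}S(\cdot,\eta).$$ Let $$\mathbb D^{J}_{g}:=\Big\{v\in C^\infty(X,S^2_{\mathbb R}T_X^{*})\ \Big|\ \nabla^{0,1}_{g,J}v_g^{*}\cdot\xi=\big(\nabla^{0,1}_{g,J}v_g^{*}\cdot\xi\big)_g^{T}\ \ \forall\,\xi\in T_X\Big\}.$$ A pair $(J,g)$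 of a smooth endomorphism section $J$ of $T_X$ and a smooth Riemannian metric $g$ is called a Kähler structure if $J^2=-\mathbb I_{T_X}$, $g(J\xi,J\eta)=g(\xi,\eta)$ for all $\xi,\eta$, and $\nabla_gJ=0$. Let $(g_t)_{t\ge 0}$ be an arbitrary smooth family of Riemannian metrics on $X$ (smooth in $(t,x)\in[0,\infty)\times X$), with time derivative $\dot g_t$ and $\dot g_t^{*}:=g_t^{-1}\dot g_t$, and let $(J_t)_{t\ge 0}$ be a family of endomorphism sections of $T_X$ which satisfies, at every point of $X$ and for all $t\ge 0$, the ODE $$2\,\dot J_t=J_t\,\dot g_t^{*}-\dot g_t^{*}\,J_t,$$ and whose initial datum $(J_0,g_0)$ is a Kähler structure (time derivatives at $t=0$ are one-sided). Then $(J_t,g_t)_{t\ge 0}$ is a smooth family of Kähler structures (i.e. $J_t$ and $g_t$ are smooth in $(t,x)\in[0,\infty)\times X$ and every $(J_t,g_t)$ is a Kähler structure) if and only if $\dot g_t\in\mathbb D^{J_t}_{g_t}$ for all $t\ge 0$. -/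

import Mathlib

open Set Manifold
open scoped ContDiff Topology

set_option maxSynthPendingDepth 3

noncomputable section

namespace KahlerVariation

variable {E : Type*} [NormedAddCommGroup E] [NormedSpace ℝ E]
  (X : Type*) [TopologicalSpace X] [ChartedSpace E X]

/-- The tangent space `T_{X,x}`. -/
abbrev Tan (x : X) : Type _ := TangentSpace 𝓘(ℝ, E) x

/-- Set-theoretic sections of the bundle of endomorphisms `End_ℝ(T_X)`. -/
abbrev EndField : Type _ := ∀ x : X, Tan (E := E) X x →L[ℝ] Tan (E := E) X x

/-- Set-theoretic sections of the bundle `T_X^* ⊗ T_X^*` of bilinear forms on `T_X`. -/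
abbrev FormField : Type _ := ∀ x : X, Tan (E := E) X x →L[ℝ] Tan (E := E) X x →L[ℝ] ℝ

/-- The smooth Riemannian metrics on `X`. -/
abbrev Metric [IsManifold 𝓘(ℝ, E) ∞ X] : Type _ :=
  Bundle.ContMDiffRiemannianMetric 𝓘(ℝ, E) ∞ E (Tan (E := E) X)

variable {X}

/-! ### Fibrewise linear algebra -/

section Algebra

/-- The endomorphism `v_g^* = g⁻¹ v` associated with a bilinear form `v`:
`g (v_g^* ξ, η) = v (ξ, η)`. -/
def sharp (g v : FormField (E := E) X) : EndField (E := E) X :=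
  fun x ↦ (g x).inverse ∘L v x

/-- The transpose `A_g^T = g⁻¹ A^* g` of an endomorphism of the tangent space at `x`. -/
def transpose (g : FormField (E := E) X) (x : X)
    (A : Tan (E := E) X x →L[ℝ] Tan (E := E) X x) : Tan (E := E) X x →L[ℝ] Tan (E := E) X x :=
  (g x).inverse ∘L (ContinuousLinearMap.precomp ℝ A) ∘L g x

end Algebra

/-! ### Smooth tensor fields and smooth families of tensor fields -/

section Smooth

variable [IsManifold 𝓘(ℝ, E) ∞ X]

/-- `A ∈ C^∞(X, End_ℝ(T_X))`. -/
def SmoothEnd (A : EndField (E := E) X) : Prop :=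
  ContMDiff 𝓘(ℝ, E) (𝓘(ℝ, E).prod 𝓘(ℝ, E →L[ℝ] E)) ∞
    (fun x ↦ Bundle.TotalSpace.mk' (E →L[ℝ] E) (E := fun x ↦ Tan (E := E) X x →L[ℝ] Tan (E := E) X x)
      x (A x))

/-- `v ∈ C^∞(X, T_X^* ⊗ T_X^*)`. -/
def SmoothForm (v : FormField (E := E) X) : Prop :=
  ContMDiff 𝓘(ℝ, E) (𝓘(ℝ, E).prod 𝓘(ℝ, E →L[ℝ] E →L[ℝ] ℝ)) ∞
    (fun x ↦ Bundle.TotalSpace.mk' (E →L[ℝ] E →L[ℝ] ℝ)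
      (E := fun x ↦ Tan (E := E) X x →L[ℝ] Tan (E := E) X x →L[ℝ] ℝ) x (v x))

/-- The family `(A_t)_{t ≥ 0}` is smooth: `A_t(x)` depends smoothly on
`(t, x) ∈ [0, ∞) × X`. -/
def SmoothEndFamily (A : ℝ → EndField (E := E) X) : Prop :=
  ContMDiffOn (𝓘(ℝ, ℝ).prod 𝓘(ℝ, E)) (𝓘(ℝ, E).prod 𝓘(ℝ, E →L[ℝ] E)) ∞
    (fun p : ℝ × X ↦ Bundle.TotalSpace.mk' (E →L[ℝ] E)
      (E := fun x ↦ Tan (E := E) X x →L[ℝ] Tan (E := E) X x) p.2 (A p.1 p.2))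
    (Ici 0 ×ˢ univ)

/-- The family `(v_t)_{t ≥ 0}` is smooth: `v_t(x)` depends smoothly on
`(t, x) ∈ [0, ∞) × X`. -/
def SmoothFormFamily (v : ℝ → FormField (E := E) X) : Prop :=
  ContMDiffOn (𝓘(ℝ, ℝ).prod 𝓘(ℝ, E)) (𝓘(ℝ, E).prod 𝓘(ℝ, E →L[ℝ] E →L[ℝ] ℝ)) ∞
    (fun p : ℝ × X ↦ Bundle.TotalSpace.mk' (E →L[ℝ] E →L[ℝ] ℝ)
      (E := fun x ↦ Tan (E := E) X x →L[ℝ] Tan (E := E) X x →L[ℝ] ℝ) p.2 (v p.1 p.2))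
    (Ici 0 ×ˢ univ)

/-- The time derivative `v̇_t` of a family `(v_t)_{t ≥ 0}` (one-sided at `t = 0`). -/
def timeDeriv (v : ℝ → FormField (E := E) X) (t : ℝ) : FormField (E := E) X :=
  fun x ↦ derivWithin (fun s ↦ v s x) (Ici 0) t

end Smooth

/-! ### The Levi-Civita connection

All covariant derivatives at the point `x` are computed in the preferred chart around `x`; this is
the chart which identifies the tangent space at `x` with `E`. -/

section Connection

variable [IsManifold 𝓘(ℝ, E) ∞ X]

/-- The coordinate frame at `p` given by the chart around `x`: it sends a vector of `E` to the
tangent vector at `p` with these coordinates. -/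
def frame (x p : X) : E →L[ℝ] Tan (E := E) X p :=
  (trivializationAt E (Tan (E := E) X) x).symmL ℝ p

/-- The coordinates in the chart around `x` of tangent vectors at `p`. -/
def coframe (x p : X) : Tan (E := E) X p →L[ℝ] E :=
  (trivializationAt E (Tan (E := E) X) x).continuousLinearMapAt ℝ p

/-- The matrix `y ↦ (v_{ij}(y))` of a bilinear form in the chart around `x`. -/
def formInChart (v : FormField (E := E) X) (x : X) (y : E) : E →L[ℝ] E →L[ℝ] ℝ :=
  let p := (extChartAt 𝓘(ℝ, E) x).symm y
  (ContinuousLinearMap.precomp ℝ (frame x p)) ∘L v p ∘L frame x p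

/-- The matrix `y ↦ (A^i_j(y))` of an endomorphism in the chart around `x`. -/
def endInChart (A : EndField (E := E) X) (x : X) (y : E) : E →L[ℝ] E :=
  let p := (extChartAt 𝓘(ℝ, E) x).symm y
  coframe x p ∘L A p ∘L frame x p

/-- The Christoffel symbols of the first kind of a field `G` of symmetric bilinear forms on the
vector space `E`:
`[u v, w] = ½ (D_u G (v, w) + D_v G (u, w) - D_w G (u, v))`, as a linear form in `w`. -/
def christoffelFirst (G : E → E →L[ℝ] E →L[ℝ] ℝ) (y : E) : E →L[ℝ] E →L[ℝ] E →L[ℝ] ℝ :=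
  let D : E →L[ℝ] E →L[ℝ] E →L[ℝ] ℝ := fderiv ℝ G y
  (1 / 2 : ℝ) •
    (D + D.flip - (ContinuousLinearMap.flipₗᵢ ℝ E E ℝ).toContinuousLinearEquiv ∘L D.flip)

/-- The Christoffel symbols `Γ(u, v)` of `G`: `G (Γ(u, v), w) = [u v, w]`. -/
def christoffel (G : E → E →L[ℝ] E →L[ℝ] ℝ) (y : E) : E →L[ℝ] E →L[ℝ] E :=
  (ContinuousLinearMap.postcomp E (G y).inverse) ∘L christoffelFirst G y

/-- The covariant derivative `∇_g A` of an endomorphism field with respect to the Levi-Civita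
connection of `g`: `∇_g A (ξ, η) = (∇_{g, ξ} A) η`, where in coordinates
`(∇_ξ A) η = (D_ξ A) η + Γ(ξ, A η) - A Γ(ξ, η)`. -/
def nabla (g : FormField (E := E) X) (A : EndField (E := E) X) (x : X) :
    Tan (E := E) X x →L[ℝ] Tan (E := E) X x →L[ℝ] Tan (E := E) X x :=
  let y : E := extChartAt 𝓘(ℝ, E) x x
  let Γ : E →L[ℝ] E →L[ℝ] E := christoffel (formInChart g x) y
  let a : E →L[ℝ] E := A x
  fderiv ℝ (endInChart A x) y
    + (ContinuousLinearMap.precomp E a) ∘L Γ - (ContinuousLinearMap.postcomp E a) ∘L Γ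

/-- `∇^{0,1}_{g,J} A (ξ, η) = ½ (∇_g A (ξ, η) + J ∇_g A (J ξ, η))`. -/
def nabla01 (g : FormField (E := E) X) (J A : EndField (E := E) X) (x : X) :
    Tan (E := E) X x →L[ℝ] Tan (E := E) X x →L[ℝ] Tan (E := E) X x :=
  let N : E →L[ℝ] E →L[ℝ] E := nabla g A x
  let j : E →L[ℝ] E := J x
  (1 / 2 : ℝ) • (N + (ContinuousLinearMap.postcomp E j) ∘L N ∘L j)

/-- The endomorphism `∇^{0,1}_{g,J} A · ξ := ∇^{0,1}_{g,J} A (·, ξ)`. -/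
def nabla01Contract (g : FormField (E := E) X) (J A : EndField (E := E) X) (x : X)
    (ξ : Tan (E := E) X x) : Tan (E := E) X x →L[ℝ] Tan (E := E) X x :=
  let N : E →L[ℝ] E →L[ℝ] E := nabla01 g J A x
  N.flip ξ

end Connection

/-! ### Kähler structures and the space `𝔻^J_g` -/

section Kahler

variable [IsManifold 𝓘(ℝ, E) ∞ X]

/-- `(J, g)` is a Kähler structure: `J` is a smooth almost complex structure,
`g (J ξ, J η) = g (ξ, η)`, and `∇_g J = 0`. -/
structure IsKahler (J : EndField (E := E) X) (g : Metric (E := E) X) : Prop where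
  smooth : SmoothEnd J
  sq : ∀ x, J x ∘L J x = -ContinuousLinearMap.id ℝ (Tan (E := E) X x)
  invariant : ∀ x ξ η, g.inner x (J x ξ) (J x η) = g.inner x ξ η
  parallel : ∀ x, nabla g.inner J x = 0

/-- `(J_t, g_t)_{t ≥ 0}` is a smooth family of Kähler structures. -/
structure IsSmoothKahlerFamily (J : ℝ → EndField (E := E) X) (g : ℝ → Metric (E := E) X) :
    Prop where
  smooth_J : SmoothEndFamily J
  smooth_g : SmoothFormFamily (fun t ↦ (g t).inner)
  kahler : ∀ t, 0 ≤ t → IsKahler (J t) (g t)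

/-- The space `𝔻^J_g` of smooth symmetric 2-tensors `v` such that for all `ξ` the endomorphism
`∇^{0,1}_{g,J} v_g^* · ξ = ∇^{0,1}_{g,J} v_g^* (·, ξ)` is equal to its `g`-transpose. -/
def spaceD (J : EndField (E := E) X) (g : Metric (E := E) X) : Set (FormField (E := E) X) :=
  {v | SmoothForm v ∧ (∀ x ξ η, v x ξ η = v x η ξ) ∧
    ∀ (x : X) (ξ : Tan (E := E) X x),
      nabla01Contract g.inner J (sharp g.inner v) x ξ =
        transpose g.inner x (nabla01Contract g.inner J (sharp g.inner v) x ξ)}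

/-- `(J_t)_{t ≥ 0}` solves the ODE `2 J̇_t = J_t ġ_t^* - ġ_t^* J_t` at every point of `X`
(with one-sided derivative at `t = 0`). -/
def SolvesODE (J : ℝ → EndField (E := E) X) (g : ℝ → Metric (E := E) X) : Prop :=
  ∀ t, 0 ≤ t → ∀ x, HasDerivWithinAt (fun s ↦ J s x)
    ((1 / 2 : ℝ) •
      (J t x ∘L sharp (g t).inner (timeDeriv (fun s ↦ (g s).inner) t) x
        - sharp (g t).inner (timeDeriv (fun s ↦ (g s).inner) t) x ∘L J t x))
    (Ici 0) t

end Kahler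

end KahlerVariation

end

open Set Manifold
open scoped ContDiff Topology

noncomputable section

/-! In a chart, let J, S and Γ be the matrices of J_t, of ġ_t^* and of the Christoffel symbols of
g_t. Everything becomes a commutator: the ODE reads 2J' = [J, S], and ∇J = 0 reads dJ = [J, Γ], that
is, dJ(u) = JΓ_u - Γ_u J (`commutatorForm`).

The ODE alone preserves J² = -1 and the compatibility with g, since the defects solve homogeneous
linear equations. Suppose J is smooth and parallel at all times. Differentiating dJ = [J, Γ] in
time, the ODE in space, and using the Jacobi identity gives [J, Γ'] = ½[J, ∇S]
(`commutatorForm_eq_iff_linearisation`). The formula for the variation of the Levi-Civita connection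
(`derivWithin_christoffel`) expresses Γ' through ∇S. As J² = -1 and J is g-antisymmetric, the
identity is then equivalent, point by point, to the symmetry defining 𝔻 (`commutatorForm_eq_iff`).

For the converse, nothing is known about the regularity of J_t in space for t > 0. At a fixed point
the 𝔻-condition says that B = [J, Γ] solves the formal linearisation of the ODE with respect to the
point, with initial value dJ_0 because J_0 is parallel. A Grönwall estimate, uniform on compact time
intervals, shows that J is then differentiable there with spatial derivative B
(`hasFDerivWithinAt_of_commutator_ode`). The definitions give this at the centre of each preferred
chart; the transformation law of the Christoffel symbols carries it to the whole chart
(`hasFDerivWithinAt_change`). So J solves a total differential system dJ = ½[J, S] dt + [J, Γ] with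
smooth coefficients. Bootstrapping makes J smooth, and the spatial part of the system is ∇J = 0. -/

namespace KahlerVariation

/-! ### Partial derivatives on [0, ∞) × U, one-sided in time -/

section Slices

variable {E F : Type*} [NormedAddCommGroup E] [NormedSpace ℝ E] [NormedAddCommGroup F]
  [NormedSpace ℝ F] {U : Set E} {f : ℝ × E → F} {t : ℝ} {y : E}

theorem uniqueDiffOn_Ici_prod (hU : IsOpen U) : UniqueDiffOn ℝ (Ici (0 : ℝ) ×ˢ U) :=
  (uniqueDiffOn_Ici 0).prod hU.uniqueDiffOn

theorem hasFDerivAt_slice (hU : IsOpen U) {f' : ℝ × E →L[ℝ] F}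
    (hf : HasFDerivWithinAt f f' (Ici (0 : ℝ) ×ˢ U) (t, y)) (ht : 0 ≤ t) (hy : y ∈ U) :
    HasFDerivAt (fun z ↦ f (t, z)) (f' ∘L .inr ℝ ℝ E) y := by
  have h : HasFDerivWithinAt (fun z : E ↦ (t, z)) (.inr ℝ ℝ E) U y :=
    (hasFDerivWithinAt_const t y U).prodMk (hasFDerivWithinAt_id y U)
  exact (HasFDerivWithinAt.comp (f := fun z : E ↦ (t, z)) y hf h
    (fun z hz ↦ ⟨ht, hz⟩)).hasFDerivAt (hU.mem_nhds hy)

theorem hasDerivWithinAt_slice {f' : ℝ × E →L[ℝ] F}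
    (hf : HasFDerivWithinAt f f' (Ici (0 : ℝ) ×ˢ U) (t, y)) (hy : y ∈ U) :
    HasDerivWithinAt (fun s ↦ f (s, y)) (f' (1, 0)) (Ici 0) t := by
  have h : HasDerivWithinAt (fun s : ℝ ↦ (s, y)) ((1 : ℝ), (0 : E)) (Ici 0) t :=
    (hasDerivWithinAt_id t _).prodMk (hasDerivWithinAt_const t _ y)
  exact HasFDerivWithinAt.comp_hasDerivWithinAt (f := fun s : ℝ ↦ (s, y)) t hf h
    (fun s hs ↦ ⟨hs, hy⟩)

theorem fderiv_slice (hU : IsOpen U) (hf : ContDiffOn ℝ ∞ f (Ici (0 : ℝ) ×ˢ U)) (ht : 0 ≤ t)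
    (hy : y ∈ U) :
    fderiv ℝ (fun z ↦ f (t, z)) y = fderivWithin ℝ f (Ici 0 ×ˢ U) (t, y) ∘L .inr ℝ ℝ E :=
  (hasFDerivAt_slice hU ((hf.differentiableOn (by simp)) (t, y) ⟨ht, hy⟩).hasFDerivWithinAt
    ht hy).fderiv

theorem derivWithin_slice (hf : ContDiffOn ℝ ∞ f (Ici (0 : ℝ) ×ˢ U)) (ht : 0 ≤ t)
    (hy : y ∈ U) :
    derivWithin (fun s ↦ f (s, y)) (Ici 0) t = fderivWithin ℝ f (Ici 0 ×ˢ U) (t, y) (1, 0) :=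
  (hasDerivWithinAt_slice ((hf.differentiableOn (by simp)) (t, y) ⟨ht, hy⟩).hasFDerivWithinAt
    hy).derivWithin (uniqueDiffOn_Ici 0 t ht)

theorem contDiffOn_fderiv_slice (hU : IsOpen U) (hf : ContDiffOn ℝ ∞ f (Ici (0 : ℝ) ×ˢ U)) :
    ContDiffOn ℝ ∞ (fun q : ℝ × E ↦ fderiv ℝ (fun z ↦ f (q.1, z)) q.2) (Ici 0 ×ˢ U) :=
  ((hf.fderivWithin (uniqueDiffOn_Ici_prod hU) (by simp)).clm_comp contDiffOn_const).congr
    fun _ hq ↦ fderiv_slice hU hf hq.1 hq.2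

theorem contDiffOn_derivWithin_slice (hU : IsOpen U)
    (hf : ContDiffOn ℝ ∞ f (Ici (0 : ℝ) ×ˢ U)) :
    ContDiffOn ℝ ∞ (fun q : ℝ × E ↦ derivWithin (fun s ↦ f (s, q.2)) (Ici 0) q.1)
      (Ici 0 ×ˢ U) :=
  ((hf.fderivWithin (uniqueDiffOn_Ici_prod hU) (by simp)).clm_apply contDiffOn_const).congr
    fun _ hq ↦ derivWithin_slice hf hq.1 hq.2

/-- Time and space derivatives commute, up to the boundary `t = 0`. -/
theorem hasDerivWithinAt_fderiv_slice (hU : IsOpen U)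
    (hf : ContDiffOn ℝ ∞ f (Ici (0 : ℝ) ×ˢ U)) (ht : 0 ≤ t) (hy : y ∈ U) :
    HasDerivWithinAt (fun s ↦ fderiv ℝ (fun z ↦ f (s, z)) y)
      (fderiv ℝ (fun z ↦ derivWithin (fun s ↦ f (s, z)) (Ici 0) t) y) (Ici 0) t := by
  have hud := uniqueDiffOn_Ici_prod hU
  have hmem : (t, y) ∈ Ici (0 : ℝ) ×ˢ U := ⟨ht, hy⟩
  have hd := hf.fderivWithin (m := ∞) hud (by simp)
  have h2 := ((hd.differentiableOn (by simp)) (t, y) hmem).hasFDerivWithinAt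
  -- Second derivatives within a set are symmetric at points of the closure of its interior, and
  -- these include the boundary t = 0.
  have hsymm : IsSymmSndFDerivWithinAt ℝ f (Ici 0 ×ˢ U) (t, y) := by
    refine (hf (t, y) hmem).isSymmSndFDerivWithinAt (by simpa using ENat.LEInfty.out) hud ?_ hmem
    rw [interior_prod_eq, interior_Ici, hU.interior_eq, closure_prod_eq, closure_Ioi]
    exact ⟨ht, subset_closure hy⟩
  have h3 := (hasDerivWithinAt_slice h2 hy).clm_comp
    (hasDerivWithinAt_const t (Ici 0) (ContinuousLinearMap.inr ℝ ℝ E))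
  have h4 : HasFDerivAt (fun z ↦ derivWithin (fun s ↦ f (s, z)) (Ici 0) t) _ y :=
    ((hasFDerivAt_slice hU h2 ht hy).clm_apply
      (hasFDerivAt_const ((1 : ℝ), (0 : E)) y)).congr_of_eventuallyEq
      (by filter_upwards [hU.mem_nhds hy] with z hz using derivWithin_slice hf ht hz)
  rw [h4.fderiv]
  refine (h3.congr_of_mem (fun s hs ↦ fderiv_slice hU hf hs hy) ht).congr_deriv ?_
  ext u
  simpa using hsymm (1, 0) (0, u)

end Slices

/-! ### Uniformity on compact time intervals -/

section Uniform

variable {E F : Type*} [NormedAddCommGroup E] [NormedAddCommGroup F] {U : Set E} {f : ℝ × E → F}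
  {y : E}

/-- A function continuous on `[0, ∞) × U` is continuous in the second variable, uniformly for
the first variable in a compact interval. -/
theorem eventually_forall_norm_sub_le (hU : IsOpen U) (hf : ContinuousOn f (Ici (0 : ℝ) ×ˢ U))
    (hy : y ∈ U) (T : ℝ) {ε : ℝ} (hε : 0 < ε) :
    ∀ᶠ z in 𝓝 y, ∀ s ∈ Icc 0 T, ‖f (s, z) - f (s, y)‖ ≤ ε := by
  -- The tube lemma for a compact interval asks for full neighbourhoods in time; placing `s ∈ Icc 0
  -- T` inside the predicate makes negative times harmless.
  refine (isCompact_Icc (a := (0 : ℝ)) (b := T)).eventually_forall_of_forall_eventually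
    (P := fun z s ↦ ?_) ?_ |>.mono ?_
  · exact s ∈ Icc 0 T → ‖f (s, z) - f (s, y)‖ ≤ ε
  · intro s hs
    have h1 : Filter.Tendsto (fun q : E × ℝ ↦ (q.2, q.1)) (𝓝[univ ×ˢ Ici 0] (y, s))
        (𝓝[Ici 0 ×ˢ U] (s, y)) := by
      refine tendsto_nhdsWithin_iff.2 ⟨?_, ?_⟩
      · exact (continuous_swap.tendsto (y, s)).mono_left nhdsWithin_le_nhds
      · have : ∀ᶠ q : E × ℝ in 𝓝 (y, s), q.1 ∈ U :=
          continuous_fst.continuousAt.eventually_mem (hU.mem_nhds hy)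
        filter_upwards [self_mem_nhdsWithin, nhdsWithin_le_nhds this] with q hq hq'
        exact ⟨hq.2, hq'⟩
    have h2 : Filter.Tendsto (fun q : E × ℝ ↦ (q.2, y)) (𝓝[univ ×ˢ Ici 0] (y, s))
        (𝓝[Ici 0 ×ˢ U] (s, y)) := by
      refine tendsto_nhdsWithin_iff.2 ⟨?_, ?_⟩
      · exact ((continuous_snd.prodMk continuous_const).tendsto (y, s)).mono_left
          nhdsWithin_le_nhds
      · filter_upwards [self_mem_nhdsWithin] with q hq
        exact ⟨hq.2, hy⟩
    have hc := hf (s, y) ⟨hs.1, hy⟩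
    have h3 := ((hc.tendsto.comp h1).sub (hc.tendsto.comp h2)).norm
    rw [sub_self, norm_zero] at h3
    have h4 := eventually_nhdsWithin_iff.1 (h3.eventually_lt_const hε)
    filter_upwards [h4] with q hq hqT
    exact (hq ⟨mem_univ _, hqT.1⟩).le
  · intro z hz s hs
    exact hz s hs hs

end Uniform

/-! ### Grönwall estimates -/

section Gronwall

variable {F : Type*} [NormedAddCommGroup F] [NormedSpace ℝ F]

/-- A single ε bounds both the initial value and the inhomogeneity, and K ≥ 1 gives ε / K ≤ ε, so
the Grönwall bound becomes linear in ε. An error of size o(‖z - y‖) in the data thus stays of that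
size. -/
theorem norm_le_of_hasDerivWithinAt_Ici {R R' : ℝ → F} {T K ε : ℝ} (hK : 1 ≤ K) (hε : 0 ≤ ε)
    (hR : ∀ s, 0 ≤ s → HasDerivWithinAt R (R' s) (Ici 0) s) (h0 : ‖R 0‖ ≤ ε)
    (h : ∀ s ∈ Icc 0 T, ‖R' s‖ ≤ K * ‖R s‖ + ε) {s : ℝ} (hs : s ∈ Icc 0 T) :
    ‖R s‖ ≤ 2 * Real.exp (K * T) * ε := by
  have h1 := norm_le_gronwallBound_of_norm_deriv_right_le (a := 0) (b := T) (f := R) (f' := R')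
    (fun s hs ↦ (hR s hs.1).continuousWithinAt.mono Icc_subset_Ici_self)
    (fun s hs ↦ (hR s hs.1).mono (Ici_subset_Ici.2 hs.1)) h0
    (fun s hs ↦ h s (Ico_subset_Icc_self hs)) s hs
  have hK0 : 0 < K := by linarith
  rw [gronwallBound_of_K_ne_0 hK0.ne', sub_zero] at h1
  have h2 : Real.exp (K * s) ≤ Real.exp (K * T) :=
    Real.exp_le_exp.2 (mul_le_mul_of_nonneg_left hs.2 hK0.le)
  have h3 : ε / K ≤ ε := div_le_self hε hK
  have h4 : 0 ≤ ε / K := div_nonneg hε hK0.le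
  have h5 : 0 < Real.exp (K * s) := Real.exp_pos _
  have h6 : ε * Real.exp (K * s) ≤ ε * Real.exp (K * T) := mul_le_mul_of_nonneg_left h2 hε
  have h7 : ε / K * Real.exp (K * s) ≤ ε * Real.exp (K * s) :=
    mul_le_mul_of_nonneg_right h3 h5.le
  simp only at h1
  linarith

/-- The case ε = 0: the continuous coefficient c is bounded on the compact interval up to s. It
shows that the defects of J² = -1 and of compatibility, zero at the start, stay zero. -/
theorem eq_zero_of_hasDerivWithinAt_Ici {R R' : ℝ → F} {c : ℝ → ℝ} (hc : ContinuousOn c (Ici 0))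
    (hR : ∀ s, 0 ≤ s → HasDerivWithinAt R (R' s) (Ici 0) s) (h0 : R 0 = 0)
    (h : ∀ s, 0 ≤ s → ‖R' s‖ ≤ c s * ‖R s‖) {s : ℝ} (hs : 0 ≤ s) : R s = 0 := by
  obtain ⟨K, hK⟩ := (isCompact_Icc (a := (0 : ℝ)) (b := s)).exists_bound_of_continuousOn
    (hc.mono Icc_subset_Ici_self)
  have h1 := norm_le_of_hasDerivWithinAt_Ici (T := s) (K := max 1 K) (le_max_left _ _) le_rfl hR
    (by simp [h0]) (fun r hr ↦ by
      have h2 : c r ≤ max 1 K := (le_abs_self _).trans ((hK r hr).trans (le_max_right _ _))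
      have := mul_le_mul_of_nonneg_right h2 (norm_nonneg (R r))
      linarith [h r hr.1]) (right_mem_Icc.2 hs)
  simpa using h1

end Gronwall

/-! ### Differentiability in the parameter for 2J' = [J, S] -/

section CommutatorODE

variable {E A : Type*} [NormedAddCommGroup E] [NormedSpace ℝ E] [NormedRing A]
  [NormedAlgebra ℝ A] {U : Set E} {S J : ℝ × E → A} {B B' : ℝ → E →L[ℝ] A} {y : E}

theorem norm_half_smul_commutator_le (a b : A) :
    ‖(1 / 2 : ℝ) • (a * b - b * a)‖ ≤ ‖b‖ * ‖a‖ := by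
  have h1 := norm_mul_le a b
  have h2 := norm_mul_le b a
  have h3 := norm_sub_le (a * b) (b * a)
  rw [norm_smul, Real.norm_of_nonneg (by norm_num)]
  linarith [mul_comm ‖a‖ ‖b‖]

/-- The mean value inequality on a ball where the spatial derivative of S oscillates by at most ε,
uniformly for times in [0, T]. -/
theorem eventually_forall_norm_sub_sub_fderiv_le (hU : IsOpen U)
    (hS : ContDiffOn ℝ ∞ S (Ici (0 : ℝ) ×ˢ U)) (hy : y ∈ U) (T : ℝ) {ε : ℝ} (hε : 0 < ε) :
    ∀ᶠ z in 𝓝 y, ∀ s ∈ Icc 0 T,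
      ‖S (s, z) - S (s, y) - fderiv ℝ (fun x ↦ S (s, x)) y (z - y)‖ ≤ ε * ‖z - y‖ := by
  have h1 := eventually_forall_norm_sub_le hU (contDiffOn_fderiv_slice hU hS).continuousOn hy T hε
  obtain ⟨δ, hδ, hball⟩ := Metric.eventually_nhds_iff_ball.1 (h1.and (hU.mem_nhds hy))
  refine Metric.eventually_nhds_iff_ball.2 ⟨δ, hδ, fun z hz s hs ↦ ?_⟩
  refine (convex_ball y δ).norm_image_sub_le_of_norm_hasFDerivWithin_le'
    (f := fun x ↦ S (s, x)) (φ := fderiv ℝ (fun x ↦ S (s, x)) y)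
    (f' := fun z ↦ fderiv ℝ (fun x ↦ S (s, x)) z) (fun w hw ↦ ?_) (fun w hw ↦ ?_)
    (Metric.mem_ball_self hδ) hz
  · have h2 := ((hS.differentiableOn (by simp)) (s, w) ⟨hs.1, (hball w hw).2⟩).hasFDerivWithinAt
    exact (hasFDerivAt_slice hU h2 hs.1 (hball w hw).2).differentiableAt.hasFDerivAt.hasFDerivWithinAt
  · exact (hball w hw).1 s hs

/-- Let `J` solve the linear equation `2 J' = [J, S]` with parameter `y`, and let `B` solve the
formal derivative of this equation with respect to the parameter, at `y`. If `B` is the derivative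
of `J` at time `0` then this holds for all times. -/
theorem eventually_forall_norm_sub_sub_le_of_commutator_ode (hU : IsOpen U)
    (hS : ContDiffOn ℝ ∞ S (Ici (0 : ℝ) ×ˢ U)) (hy : y ∈ U)
    (hJ : ∀ s, 0 ≤ s → ∀ z ∈ U, HasDerivWithinAt (fun r ↦ J (r, z))
      ((1 / 2 : ℝ) • (J (s, z) * S (s, z) - S (s, z) * J (s, z))) (Ici 0) s)
    (hB : ∀ s, 0 ≤ s → HasDerivWithinAt B (B' s) (Ici 0) s)
    (hB' : ∀ s, 0 ≤ s → ∀ u, B' s u = (1 / 2 : ℝ) • (B s u * S (s, y) - S (s, y) * B s u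
      + (J (s, y) * fderiv ℝ (fun x ↦ S (s, x)) y u - fderiv ℝ (fun x ↦ S (s, x)) y u * J (s, y))))
    (h0 : HasFDerivAt (fun z ↦ J (0, z)) (B 0) y) (T : ℝ) {ε : ℝ} (hε : 0 < ε) :
    ∀ᶠ z in 𝓝 y, ∀ s ∈ Icc 0 T, ‖J (s, z) - J (s, y) - B s (z - y)‖ ≤ ε * ‖z - y‖ := by
  obtain ⟨M₁, hM₁⟩ := (isCompact_Icc (a := (0 : ℝ)) (b := T)).exists_bound_of_continuousOn
    (f := fun s ↦ S (s, y)) (hS.continuousOn.comp (by fun_prop) (fun s hs ↦ ⟨hs.1, hy⟩))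
  obtain ⟨M₂, hM₂⟩ := (isCompact_Icc (a := (0 : ℝ)) (b := T)).exists_bound_of_continuousOn
    (f := fun s ↦ J (s, y)) (fun s hs ↦ (hJ s hs.1 y hy).continuousWithinAt.mono
      Icc_subset_Ici_self)
  obtain ⟨M₃, hM₃⟩ := (isCompact_Icc (a := (0 : ℝ)) (b := T)).exists_bound_of_continuousOn
    (f := B) (fun s hs ↦ (hB s hs.1).continuousWithinAt.mono Icc_subset_Ici_self)
  set M : ℝ := |M₁| + |M₂| + |M₃| + 1
  have hM1 : 1 ≤ M := by linarith [abs_nonneg M₁, abs_nonneg M₂, abs_nonneg M₃]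
  have hM1' : |M₁| ≤ M := by linarith [abs_nonneg M₁, abs_nonneg M₂, abs_nonneg M₃]
  have hM2' : |M₂| ≤ M := by linarith [abs_nonneg M₁, abs_nonneg M₂, abs_nonneg M₃]
  have hM3' : |M₃| ≤ M := by linarith [abs_nonneg M₁, abs_nonneg M₂, abs_nonneg M₃]
  have hexp := Real.exp_pos ((M + 1) * T)
  set c : ℝ := Real.exp ((M + 1) * T)
  -- Chosen so that the final Grönwall bound 2c · (2Mη‖z - y‖) equals ε‖z - y‖.
  set η : ℝ := ε / (4 * M * c) with hη
  have hη0 : 0 < η := by positivity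
  filter_upwards [eventually_forall_norm_sub_sub_fderiv_le hU hS hy T hη0,
    eventually_forall_norm_sub_le hU hS.continuousOn hy T hη0,
    eventually_forall_norm_sub_le hU hS.continuousOn hy T one_pos, hU.mem_nhds hy,
    h0.isLittleO.def hη0] with z h1 h2 h3 hz h4 s hs
  have hu : 0 ≤ ‖z - y‖ := norm_nonneg _
  -- Grönwall for the first-order remainder R. The rate M + 1 bounds S at z, which is within
  -- distance 1 of S at y; the inhomogeneity 2Mη‖z - y‖ collects two terms of size Mη‖z - y‖.
  have key := norm_le_of_hasDerivWithinAt_Ici (T := T) (K := M + 1) (ε := 2 * M * η * ‖z - y‖)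
    (R := fun s ↦ J (s, z) - J (s, y) - B s (z - y))
    (R' := fun s ↦ (1 / 2 : ℝ) • (J (s, z) * S (s, z) - S (s, z) * J (s, z))
      - (1 / 2 : ℝ) • (J (s, y) * S (s, y) - S (s, y) * J (s, y)) - B' s (z - y))
    (by linarith) (by positivity)
    (fun r hr ↦ ((hJ r hr z hz).sub (hJ r hr y hy)).sub
      ((hB r hr).clm_apply (hasDerivWithinAt_const _ _ _) |>.congr_deriv (by simp)))
    (by
      refine h4.trans ?_
      have : 0 ≤ η * ‖z - y‖ := by positivity
      nlinarith)
    (fun r hr ↦ ?_) hs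
  · refine key.trans (le_of_eq ?_)
    rw [hη]
    field_simp
    ring
  · set u := z - y
    set D := fderiv ℝ (fun x ↦ S (r, x)) y u with hD
    -- With u = z - y and D = dS(u), this says 2R' = [R, S(z)] + [J(y), S(z) - S(y) - D] + [B u,
    -- S(z) - S(y)]. The first term is linear in R; the others are small by the differentiability
    -- and the continuity of S.
    have e : (1 / 2 : ℝ) • (J (r, z) * S (r, z) - S (r, z) * J (r, z))
        - (1 / 2 : ℝ) • (J (r, y) * S (r, y) - S (r, y) * J (r, y)) - B' r u
        = (1 / 2 : ℝ) • ((J (r, z) - J (r, y) - B r u) * S (r, z)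
            - S (r, z) * (J (r, z) - J (r, y) - B r u))
          + (1 / 2 : ℝ) • (J (r, y) * (S (r, z) - S (r, y) - D)
            - (S (r, z) - S (r, y) - D) * J (r, y))
          + (1 / 2 : ℝ) • (B r u * (S (r, z) - S (r, y)) - (S (r, z) - S (r, y)) * B r u) := by
      rw [hB' r hr.1, ← hD, ← smul_sub, ← smul_sub, ← smul_add, ← smul_add]
      congr 1
      noncomm_ring
    rw [e]
    have n1 := norm_half_smul_commutator_le (J (r, z) - J (r, y) - B r u) (S (r, z))
    have n2 := norm_half_smul_commutator_le (J (r, y)) (S (r, z) - S (r, y) - D)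
    have n3 := norm_half_smul_commutator_le (B r u) (S (r, z) - S (r, y))
    have n4 := norm_add₃_le (a := (1 / 2 : ℝ) • ((J (r, z) - J (r, y) - B r u) * S (r, z)
            - S (r, z) * (J (r, z) - J (r, y) - B r u)))
          (b := (1 / 2 : ℝ) • (J (r, y) * (S (r, z) - S (r, y) - D)
            - (S (r, z) - S (r, y) - D) * J (r, y)))
          (c := (1 / 2 : ℝ) • (B r u * (S (r, z) - S (r, y)) - (S (r, z) - S (r, y)) * B r u))
    have b1 : ‖S (r, z)‖ ≤ M + 1 := by
      have := norm_sub_norm_le (S (r, z)) (S (r, y))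
      have h5 := (hM₁ r hr).trans (le_abs_self _)
      linarith [h3 r hr]
    have b2 : ‖J (r, y)‖ ≤ M := ((hM₂ r hr).trans (le_abs_self _)).trans hM2'
    have b3 : ‖B r u‖ ≤ M * ‖u‖ := (B r).le_of_opNorm_le
      (((hM₃ r hr).trans (le_abs_self _)).trans hM3') u
    have c1 := mul_le_mul_of_nonneg_right b1 (norm_nonneg (J (r, z) - J (r, y) - B r u))
    have c2 := mul_le_mul (h1 r hr) b2 (norm_nonneg _) (by positivity)
    have c3 := mul_le_mul (h2 r hr) b3 (norm_nonneg _) hη0.le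
    linarith

/-- The increment of J splits into the spatial remainder at time s, the time remainder at y, and (B
s - B t)(z - y). The first is controlled uniformly for s ≤ t + 1, an interval containing a
neighbourhood of t in [0, ∞); the second by the ODE; the third by continuity of B. -/
theorem hasFDerivWithinAt_of_commutator_ode (hU : IsOpen U)
    (hS : ContDiffOn ℝ ∞ S (Ici (0 : ℝ) ×ˢ U)) (hy : y ∈ U)
    (hJ : ∀ s, 0 ≤ s → ∀ z ∈ U, HasDerivWithinAt (fun r ↦ J (r, z))
      ((1 / 2 : ℝ) • (J (s, z) * S (s, z) - S (s, z) * J (s, z))) (Ici 0) s)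
    (hB : ∀ s, 0 ≤ s → HasDerivWithinAt B (B' s) (Ici 0) s)
    (hB' : ∀ s, 0 ≤ s → ∀ u, B' s u = (1 / 2 : ℝ) • (B s u * S (s, y) - S (s, y) * B s u
      + (J (s, y) * fderiv ℝ (fun x ↦ S (s, x)) y u - fderiv ℝ (fun x ↦ S (s, x)) y u * J (s, y))))
    (h0 : HasFDerivAt (fun z ↦ J (0, z)) (B 0) y) {t : ℝ} (ht : 0 ≤ t) :
    HasFDerivWithinAt J
      ((ContinuousLinearMap.fst ℝ ℝ E).smulRight
        ((1 / 2 : ℝ) • (J (t, y) * S (t, y) - S (t, y) * J (t, y)))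
        + B t ∘L ContinuousLinearMap.snd ℝ ℝ E) (Ici 0 ×ˢ U) (t, y) := by
  refine .of_isLittleO (Asymptotics.isLittleO_iff.2 fun ε hε ↦ ?_)
  have hε3 : 0 < ε / 3 := by positivity
  have hfst : Filter.Tendsto Prod.fst (𝓝[Ici (0 : ℝ) ×ˢ U] (t, y)) (𝓝[Ici 0] t) :=
    tendsto_nhdsWithin_iff.2 ⟨(continuous_fst.tendsto (t, y)).mono_left nhdsWithin_le_nhds,
      by filter_upwards [self_mem_nhdsWithin] with q hq using hq.1⟩
  have hsnd : Filter.Tendsto Prod.snd (𝓝[Ici (0 : ℝ) ×ˢ U] (t, y)) (𝓝 y) :=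
    (continuous_snd.tendsto (t, y)).mono_left nhdsWithin_le_nhds
  have e1 := hsnd.eventually
    (eventually_forall_norm_sub_sub_le_of_commutator_ode hU hS hy hJ hB hB' h0 (t + 1) hε3)
  have e2 := hfst.eventually ((hJ t ht y hy).hasFDerivWithinAt.isLittleO.def hε3)
  have e3 := hfst.eventually ((tendsto_iff_norm_sub_tendsto_zero.1
    (hB t ht).continuousWithinAt.tendsto).eventually_le_const hε3)
  have e4 : ∀ᶠ q : ℝ × E in 𝓝[Ici (0 : ℝ) ×ˢ U] (t, y), q.1 ≤ t + 1 :=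
    hfst.eventually (nhdsWithin_le_nhds (eventually_le_nhds (lt_add_one t)))
  filter_upwards [e1, e2, e3, e4, self_mem_nhdsWithin] with q h1 h2 h3 h4 hq
  obtain ⟨s, z⟩ := q
  have h1 := h1 s ⟨hq.1, h4⟩
  have n1 : ‖s - t‖ ≤ ‖(s, z) - (t, y)‖ := norm_fst_le ((s, z) - (t, y))
  have n2 : ‖z - y‖ ≤ ‖(s, z) - (t, y)‖ := norm_snd_le ((s, z) - (t, y))
  have e : J (s, z) - J (t, y) - ((ContinuousLinearMap.fst ℝ ℝ E).smulRight
        ((1 / 2 : ℝ) • (J (t, y) * S (t, y) - S (t, y) * J (t, y)))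
        + B t ∘L ContinuousLinearMap.snd ℝ ℝ E) ((s, z) - (t, y))
      = (J (s, z) - J (s, y) - B s (z - y)) + (J (s, y) - J (t, y)
        - (s - t) • ((1 / 2 : ℝ) • (J (t, y) * S (t, y) - S (t, y) * J (t, y))))
        + (B s - B t) (z - y) := by
    simp only [Prod.mk_sub_mk, add_apply, ContinuousLinearMap.smulRight_apply,
      ContinuousLinearMap.coe_fst', ContinuousLinearMap.comp_apply, ContinuousLinearMap.coe_snd',
      sub_apply]
    abel
  rw [e]
  have h5 := (B s - B t).le_of_opNorm_le h3 (z - y)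
  have h2 : ‖J (s, y) - J (t, y)
        - (s - t) • ((1 / 2 : ℝ) • (J (t, y) * S (t, y) - S (t, y) * J (t, y)))‖
        ≤ ε / 3 * ‖s - t‖ := by simpa using h2
  refine norm_add₃_le.trans ?_
  have m1 := mul_le_mul_of_nonneg_left n1 hε3.le
  have m2 := mul_le_mul_of_nonneg_left n2 hε3.le
  linarith

end CommutatorODE

/-! ### The Levi-Civita connection in coordinates -/

section Christoffel

variable {E : Type*} [NormedAddCommGroup E] [NormedSpace ℝ E] {G : E → E →L[ℝ] E →L[ℝ] ℝ} {y : E}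

theorem christoffel_apply (hG : (G y).IsInvertible) (u v w : E) :
    G y (christoffel G y u v) w =
      (1 / 2 : ℝ) * (fderiv ℝ G y u v w + fderiv ℝ G y v u w - fderiv ℝ G y w u v) := by
  have h : G y (christoffel G y u v) = christoffelFirst G y u v := hG.self_apply_inverse _
  rw [h]
  rfl

theorem fderiv_apply_symm (hd : DifferentiableAt ℝ G y)
    (hs : ∀ᶠ z in 𝓝 y, ∀ v w, G z v w = G z w v)
    (u v w : E) : fderiv ℝ G y u v w = fderiv ℝ G y u w v := by
  have h (a b : E) : HasFDerivAt (fun z ↦ G z a b) _ y :=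
    (hd.hasFDerivAt.clm_apply (hasFDerivAt_const a y)).clm_apply (hasFDerivAt_const b y)
  have h2 := (h v w).congr_of_eventuallyEq (hs.mono fun z hz ↦ (hz v w).symm)
  simpa using DFunLike.congr_fun (h2.unique (h w v)) u

theorem christoffel_symm (hG : (G y).IsInvertible) (hd : DifferentiableAt ℝ G y)
    (hs : ∀ᶠ z in 𝓝 y, ∀ v w, G z v w = G z w v) (u v : E) :
    christoffel G y u v = christoffel G y v u := by
  apply hG.injective
  ext w
  rw [christoffel_apply hG, christoffel_apply hG, fderiv_apply_symm hd hs w u v]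
  ring

/-- Compatibility with the metric: in the sum of the two Koszul formulas all other derivatives of G
cancel by symmetry. -/
theorem fderiv_eq_christoffel (hG : (G y).IsInvertible) (hd : DifferentiableAt ℝ G y)
    (hs : ∀ᶠ z in 𝓝 y, ∀ v w, G z v w = G z w v) (u v w : E) :
    fderiv ℝ G y u v w = G y (christoffel G y u v) w + G y v (christoffel G y u w) := by
  rw [hs.self_of_nhds v, christoffel_apply hG, christoffel_apply hG,
    fderiv_apply_symm hd hs u w v, fderiv_apply_symm hd hs v u w, fderiv_apply_symm hd hs w u v]
  ring

/-- The Levi-Civita connection is the only torsion-free metric connection. -/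
theorem eq_christoffel (hG : (G y).IsInvertible)
    (hs : ∀ v w, G y v w = G y w v) {Γ : E → E → E} (hΓ : ∀ u v, Γ u v = Γ v u)
    (hc : ∀ u v w, fderiv ℝ G y u v w = G y (Γ u v) w + G y v (Γ u w)) (u v : E) :
    Γ u v = christoffel G y u v := by
  apply hG.injective
  ext w
  rw [christoffel_apply hG, hc, hc, hc, hΓ v u, hΓ w u, hΓ w v, hs u, hs v (Γ u w),
    hs (Γ u w) v, hs v (Γ u w)]
  ring

end Christoffel

/-! ### Variation of the Christoffel symbols -/

section Variation

variable {E : Type*} [NormedAddCommGroup E] [NormedSpace ℝ E]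
  {G : ℝ × E → E →L[ℝ] E →L[ℝ] ℝ} {S J : ℝ × E → E →L[ℝ] E} {U : Set E} {t : ℝ} {y : E}

theorem contDiffOn_christoffel [CompleteSpace E] (hU : IsOpen U)
    (hG : ContDiffOn ℝ ∞ G (Ici (0 : ℝ) ×ˢ U))
    (hi : ∀ q ∈ Ici (0 : ℝ) ×ˢ U, (G q).IsInvertible) :
    ContDiffOn ℝ ∞ (fun q : ℝ × E ↦ christoffel (fun z ↦ G (q.1, z)) q.2) (Ici 0 ×ˢ U) := by
  have hD := contDiffOn_fderiv_slice hU hG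
  have hflip : ContDiffOn ℝ ∞ (fun q : ℝ × E ↦ (fderiv ℝ (fun z ↦ G (q.1, z)) q.2).flip)
      (Ici 0 ×ˢ U) :=
    (ContinuousLinearMap.flipₗᵢ ℝ E E (E →L[ℝ] ℝ)).contDiff.comp_contDiffOn hD
  have h1 : ContDiffOn ℝ ∞ (fun q : ℝ × E ↦ christoffelFirst (fun z ↦ G (q.1, z)) q.2)
      (Ici 0 ×ˢ U) :=
    ((hD.add hflip).sub (contDiffOn_const.clm_comp hflip)).const_smul _
  have h2 : ContDiffOn ℝ ∞ (fun q ↦ (G q).inverse) (Ici (0 : ℝ) ×ˢ U) := fun q hq ↦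
    (hi q hq).contDiffAt_map_inverse.comp_contDiffWithinAt q (hG q hq)
  exact (((ContinuousLinearMap.compL ℝ E (E →L[ℝ] ℝ) E).contDiff).comp_contDiffOn h2).clm_comp h1

/-- The operator `u ↦ a Γ_u - Γ_u a`. -/
def commutatorForm (a : E →L[ℝ] E) (Γ : E →L[ℝ] E →L[ℝ] E) : E →L[ℝ] E →L[ℝ] E :=
  (ContinuousLinearMap.postcomp E a) ∘L Γ - (ContinuousLinearMap.precomp E a) ∘L Γ

theorem commutatorForm_apply (a : E →L[ℝ] E) (Γ : E →L[ℝ] E →L[ℝ] E) (u : E) :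
    commutatorForm a Γ u = a * Γ u - Γ u * a := rfl

/-- The covariant derivative `∇S` in coordinates. -/
def covariantDeriv (G : E → E →L[ℝ] E →L[ℝ] ℝ) (S : E → E →L[ℝ] E) (y : E) :
    E →L[ℝ] E →L[ℝ] E :=
  fderiv ℝ S y - commutatorForm (S y) (christoffel G y)

/-- The variation of the Christoffel symbols:
`2 G (Γ' (u, v), w) = G (∇S (u, v), w) + G (∇S (v, u), w) - G (∇S (w, u), v)`. -/
theorem derivWithin_christoffel [CompleteSpace E] (hU : IsOpen U)
    (hG : ContDiffOn ℝ ∞ G (Ici (0 : ℝ) ×ˢ U))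
    (hi : ∀ q ∈ Ici (0 : ℝ) ×ˢ U, (G q).IsInvertible)
    (hs : ∀ q ∈ Ici (0 : ℝ) ×ˢ U, ∀ v w, G q v w = G q w v)
    (hS : ContDiffOn ℝ ∞ S (Ici (0 : ℝ) ×ˢ U))
    (hGS : ∀ q ∈ Ici (0 : ℝ) ×ˢ U, ∀ v,
      G q (S q v) = derivWithin (fun s ↦ G (s, q.2)) (Ici 0) q.1 v)
    (ht : 0 ≤ t) (hy : y ∈ U) (u v w : E) :
    2 * G (t, y) (derivWithin (fun s ↦ christoffel (fun z ↦ G (s, z)) y) (Ici 0) t u v) w =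
      G (t, y) (covariantDeriv (fun z ↦ G (t, z)) (fun z ↦ S (t, z)) y u v) w
      + G (t, y) (covariantDeriv (fun z ↦ G (t, z)) (fun z ↦ S (t, z)) y v u) w
      - G (t, y) (covariantDeriv (fun z ↦ G (t, z)) (fun z ↦ S (t, z)) y w u) v := by
  have hq : (t, y) ∈ Ici (0 : ℝ) ×ˢ U := ⟨ht, hy⟩
  have hΓ := contDiffOn_christoffel hU hG hi
  set Γ := christoffel (fun z ↦ G (t, z)) y
  have dG := hasDerivWithinAt_slice ((hG.differentiableOn (by simp)) _ hq).hasFDerivWithinAt hy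
  rw [← derivWithin_slice hG ht hy] at dG
  have dΓ := hasDerivWithinAt_slice ((hΓ.differentiableOn (by simp)) _ hq).hasFDerivWithinAt hy
  rw [← derivWithin_slice hΓ ht hy] at dΓ
  have dD := hasDerivWithinAt_fderiv_slice hU hG ht hy
  set G' := derivWithin (fun s ↦ G (s, y)) (Ici 0) t
  set D' := fderiv ℝ (fun z ↦ derivWithin (fun s ↦ G (s, z)) (Ici 0) t) y
  set Γ' := derivWithin (fun s ↦ christoffel (fun z ↦ G (s, z)) y) (Ici 0) t
  have c (a : E) : HasDerivWithinAt (fun _ : ℝ ↦ a) 0 (Ici 0) t := hasDerivWithinAt_const _ _ _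
  -- differentiate the definition of `Γ` in time
  have e1 : G' (Γ u v) w + G (t, y) (Γ' u v) w =
      (1 / 2 : ℝ) * (D' u v w + D' v u w - D' w u v) := by
    have h1 := (dG.clm_apply ((dΓ.clm_apply (c u)).clm_apply (c v))).clm_apply (c w)
    have h2 (a b d : E) := ((dD.clm_apply (c a)).clm_apply (c b)).clm_apply (c d)
    have h3 := (((h2 u v w).add (h2 v u w)).sub (h2 w u v)).const_mul (1 / 2 : ℝ)
    have h4 := h3.congr_of_mem (fun s hs ↦ christoffel_apply (hi (s, y) ⟨hs, hy⟩) u v w) ht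
    simpa using ((uniqueDiffOn_Ici 0 t ht).eq_deriv _ h1 h4)
  have dGy : DifferentiableAt ℝ (fun z ↦ G (t, z)) y :=
    (hasFDerivAt_slice hU ((hG.differentiableOn (by simp)) _ hq).hasFDerivWithinAt
      ht hy).differentiableAt
  have dSy : DifferentiableAt ℝ (fun z ↦ S (t, z)) y :=
    (hasFDerivAt_slice hU ((hS.differentiableOn (by simp)) _ hq).hasFDerivWithinAt
      ht hy).differentiableAt
  have dG'y : DifferentiableAt ℝ (fun z ↦ derivWithin (fun s ↦ G (s, z)) (Ici 0) t) y :=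
    (hasFDerivAt_slice hU (((contDiffOn_derivWithin_slice hU hG).differentiableOn
      (by simp)) _ hq).hasFDerivWithinAt ht hy).differentiableAt
  have hsU : ∀ᶠ z in 𝓝 y, ∀ v w, G (t, z) v w = G (t, z) w v :=
    (hU.eventually_mem hy).mono fun z hz ↦ hs _ ⟨ht, hz⟩
  -- differentiate the definition of `S` in space
  have e2 (a b d : E) : D' a b d = fderiv ℝ (fun z ↦ G (t, z)) y a (S (t, y) b) d
      + G (t, y) (fderiv ℝ (fun z ↦ S (t, z)) y a b) d := by
    have k (a : E) : HasFDerivAt (fun _ : E ↦ a) (0 : E →L[ℝ] E) y := hasFDerivAt_const _ _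
    have h1 := (dG'y.hasFDerivAt.clm_apply (k b)).clm_apply (k d)
    have h2 := (dGy.hasFDerivAt.clm_apply (dSy.hasFDerivAt.clm_apply (k b))).clm_apply (k d)
    have h3 : (fun z ↦ G (t, z) (S (t, z) b) d) =ᶠ[𝓝 y]
        fun z ↦ derivWithin (fun s ↦ G (s, z)) (Ici 0) t b d :=
      (hU.eventually_mem hy).mono fun z hz ↦ DFunLike.congr_fun (hGS (t, z) ⟨ht, hz⟩ b) d
    have h3 := h1.congr_of_eventuallyEq h3
    have h4 := DFunLike.congr_fun (h3.unique h2) a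
    simp at h4
    linarith
  have e3 (b d : E) : G (t, y) (S (t, y) b) d = G' b d := DFunLike.congr_fun (hGS _ hq b) d
  have e4 (a b d : E) := fderiv_eq_christoffel (hi _ hq) dGy hsU a b d
  have e5 (a b : E) : Γ a b = Γ b a := christoffel_symm (hi _ hq) dGy hsU a b
  have e6 (b d : E) : G' b d = G' d b := by
    have h1 (b d : E) := (dG.clm_apply (c b)).clm_apply (c d)
    have h2 := (h1 b d).congr_of_mem (fun s hs' ↦ hs (s, y) ⟨hs', hy⟩ d b) ht
    simpa using ((uniqueDiffOn_Ici 0 t ht).eq_deriv _ h2 (h1 d b))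
  -- Since G is parallel, lowering an index commutes with ∇: the right side is (∇_a G')(b, d). The
  -- claim thus reduces to the classical variation formula in terms of ∇G'.
  have e7 (a b d : E) : G (t, y) (covariantDeriv (fun z ↦ G (t, z)) (fun z ↦ S (t, z)) y a b) d =
      D' a b d - G' (Γ a b) d - G' b (Γ a d) := by
    have h1 : covariantDeriv (fun z ↦ G (t, z)) (fun z ↦ S (t, z)) y a b =
      fderiv ℝ (fun z ↦ S (t, z)) y a b - (S (t, y) (Γ a b) - Γ a (S (t, y) b)) := rfl
    rw [h1, e2, e4]
    simp only [map_sub, sub_apply, e3]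
    ring
  rw [e7, e7, e7]
  rw [e5 v u, e5 w u, e5 w v, e6 u, e6 v (Γ u w), e6 (Γ u w) v]
  linarith

end Variation

/-! ### The 𝔻-condition as pointwise linear algebra -/

section Algebra

variable {E : Type*} [NormedAddCommGroup E] [NormedSpace ℝ E]

/-- The symmetry condition on `N^{0,1} (u, ξ) = ½ (N (u, ξ) + a N (a u, ξ))` in terms of the variation
`Γ'` of the connection with `2 B (Γ' (u, v), w) = B (N (u, v), w) + B (N (v, u), w) - B (N (w, u), v)`. -/
theorem commutatorForm_eq_iff {B : E →L[ℝ] E →L[ℝ] ℝ} (hB : B.IsInvertible)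
    (hs : ∀ v w, B v w = B w v) {a : E →L[ℝ] E} (ha : ∀ v, a (a v) = -v)
    (hBa : ∀ v w, B (a v) w = -B v (a w)) {Γ' N : E →L[ℝ] E →L[ℝ] E}
    (hΓ : ∀ u v w, 2 * B (Γ' u v) w = B (N u v) w + B (N v u) w - B (N w u) v) :
    commutatorForm a Γ' = (1 / 2 : ℝ) • commutatorForm a N ↔
      ∀ ξ v w, B ((1 / 2 : ℝ) • (N v ξ + a (N (a v) ξ))) w
        = B v ((1 / 2 : ℝ) • (N w ξ + a (N (a w) ξ))) := by
  -- Both defects depend only on the skew form P_ξ(v, w) = B(N(v, ξ), w) - B(N(w, ξ), v): here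
  -- -½(P_u(v, aw) + P_u(av, w)), and in `key2` ½(P_ξ(v, w) - P_ξ(av, aw)). As a² = -1, replacing w
  -- by aw turns the first into the second.
  have key (u v w : E) : B (commutatorForm a Γ' u v) w
      - B (((1 / 2 : ℝ) • commutatorForm a N) u v) w
      = -(1 / 2) * (B (N v u) (a w) - B (N (a w) u) v + (B (N (a v) u) w - B (N w u) (a v))) := by
    have h1 := hΓ u v (a w)
    have h2 := hΓ u (a v) w
    have h3 : B (commutatorForm a Γ' u v) w = B (a (Γ' u v)) w - B (Γ' u (a v)) w := by
      rw [commutatorForm_apply]; simp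
    have h4 : B (((1 / 2 : ℝ) • commutatorForm a N) u v) w
        = (1 / 2) * (B (a (N u v)) w - B (N u (a v)) w) := by
      rw [smul_apply, commutatorForm_apply]; simp
    rw [h3, h4, hBa, hBa]
    linarith
  have key2 (ξ v w : E) : B ((1 / 2 : ℝ) • (N v ξ + a (N (a v) ξ))) w
        - B v ((1 / 2 : ℝ) • (N w ξ + a (N (a w) ξ)))
      = (1 / 2) * (B (N v ξ) w - B (N w ξ) v - (B (N (a v) ξ) (a w) - B (N (a w) ξ) (a v))) := by
    have h1 := hBa (N (a w) ξ) v
    simp only [map_smul, map_add, smul_apply, add_apply, smul_eq_mul, hBa (N (a v) ξ)]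
    rw [hs v, hs v, h1]
    ring
  constructor
  · intro h ξ v w
    have h1 := key ξ v (a w)
    rw [h, sub_self, ha] at h1
    have h2 := key2 ξ v w
    simp only [map_neg, neg_apply] at h1
    linarith
  · intro h
    ext u v
    apply hB.injective
    ext w
    have h1 := key u v w
    have h2 := key2 u v (a w)
    rw [h, sub_self, ha] at h2
    simp only [map_neg, neg_apply] at h2
    linarith

end Algebra

/-! ### Linearised equation and conserved identities -/

section Variation

variable {E : Type*} [NormedAddCommGroup E] [NormedSpace ℝ E]
  {G : ℝ × E → E →L[ℝ] E →L[ℝ] ℝ} {S J : ℝ × E → E →L[ℝ] E} {U : Set E} {t : ℝ} {y : E}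

theorem hasDerivWithinAt_commutatorForm {a : ℝ → E →L[ℝ] E} {Γ : ℝ → E →L[ℝ] E →L[ℝ] E}
    {a' : E →L[ℝ] E} {Γ' : E →L[ℝ] E →L[ℝ] E} {s : Set ℝ} (ha : HasDerivWithinAt a a' s t)
    (hΓ : HasDerivWithinAt Γ Γ' s t) :
    HasDerivWithinAt (fun r ↦ commutatorForm (a r) (Γ r))
      (commutatorForm a' (Γ t) + commutatorForm (a t) Γ') s t := by
  have h1 := ((ContinuousLinearMap.compL ℝ E E E).hasFDerivAt.comp_hasDerivWithinAt t ha).clm_comp hΓ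
  have h2 := ((ContinuousLinearMap.compL ℝ E E E).flip.hasFDerivAt.comp_hasDerivWithinAt t
    ha).clm_comp hΓ
  refine (h1.sub h2).congr_deriv ?_
  ext u v
  simp [commutatorForm_apply]
  abel

/-- The linearisation of `2 a' = [a, S]` holds for `b = [a, Γ]` if and only if
`[a, Γ'] = ½ [a, ∇S]`. -/
theorem commutatorForm_eq_iff_linearisation {a s : E →L[ℝ] E} {Γ Γ' ds : E →L[ℝ] E →L[ℝ] E} :
    (∀ u, (commutatorForm ((1 / 2 : ℝ) • (a * s - s * a)) Γ + commutatorForm a Γ') u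
      = (1 / 2 : ℝ) • (commutatorForm a Γ u * s - s * commutatorForm a Γ u
        + (a * ds u - ds u * a))) ↔
    commutatorForm a Γ' = (1 / 2 : ℝ) • commutatorForm a (ds - commutatorForm s Γ) := by
  rw [ContinuousLinearMap.ext_iff]
  refine forall_congr' fun u ↦ ?_
  simp only [add_apply, smul_apply, commutatorForm_apply, sub_apply]
  rw [← sub_eq_zero, ← sub_eq_zero (a := a * Γ' u - Γ' u * a)]
  refine Eq.congr_left ?_
  simp only [smul_mul_assoc, mul_smul_comm, ← smul_sub]
  -- Doubling [a, Γ'_u] lets the common factor ½ be removed; what remains is the Jacobi identity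
  -- [[a, s], Γ_u] - [[a, Γ_u], s] = [a, [s, Γ_u]].
  have : a * Γ' u - Γ' u * a = (1 / 2 : ℝ) • ((a * Γ' u - Γ' u * a) + (a * Γ' u - Γ' u * a)) := by
    rw [← two_smul ℝ, smul_smul]; norm_num
  rw [this, ← smul_add, ← smul_sub, ← smul_sub]
  congr 1
  noncomm_ring

/-- Since [·, s] is a derivation that kills 1, the defect R = a² + 1 satisfies 2R' = [R, s]. -/
theorem mul_self_eq_neg_one_of_commutator_ode {a s : ℝ → E →L[ℝ] E} (hs : ContinuousOn s (Ici 0))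
    (ha : ∀ r, 0 ≤ r → HasDerivWithinAt a ((1 / 2 : ℝ) • (a r * s r - s r * a r)) (Ici 0) r)
    (h0 : a 0 * a 0 = -1) (ht : 0 ≤ t) : a t * a t = -1 := by
  refine eq_neg_of_add_eq_zero_left (eq_zero_of_hasDerivWithinAt_Ici
    (R := fun r ↦ a r * a r + 1) (c := fun r ↦ ‖s r‖)
    hs.norm (fun r hr ↦ ((ha r hr).mul (ha r hr)).add_const 1) (by simp [h0]) (fun r hr ↦ ?_) ht)
  refine le_of_eq_of_le (congrArg _ ?_) (norm_half_smul_commutator_le (a r * a r + 1) (s r))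
  simp only [smul_mul_assoc, mul_smul_comm, ← smul_add]
  congr 1
  noncomm_ring

/-- The defect is Q(v, w) = g(av, w) + g(aw, v). Because g' = g(s·, ·) and s is g-self-adjoint, 2Q'
= Q(s·, ·) + Q(·, s·), a homogeneous linear equation. -/
theorem antisymm_of_commutator_ode {a s : ℝ → E →L[ℝ] E} {g g' : ℝ → E →L[ℝ] E →L[ℝ] ℝ}
    (hs : ContinuousOn s (Ici 0))
    (ha : ∀ r, 0 ≤ r → HasDerivWithinAt a ((1 / 2 : ℝ) • (a r * s r - s r * a r)) (Ici 0) r)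
    (hg : ∀ r, 0 ≤ r → HasDerivWithinAt g (g' r) (Ici 0) r)
    (hgs : ∀ r, 0 ≤ r → ∀ v w, g r v w = g r w v) (hgs' : ∀ r, 0 ≤ r → ∀ v w, g' r v w = g' r w v)
    (hsg : ∀ r, 0 ≤ r → ∀ v, g r (s r v) = g' r v)
    (h0 : ∀ v w, g 0 (a 0 v) w = -g 0 v (a 0 w)) (ht : 0 ≤ t) (v w : E) :
    g t (a t v) w = -g t v (a t w) := by
  let Q : ℝ → E →L[ℝ] E →L[ℝ] ℝ := fun r ↦ g r ∘L a r + (g r ∘L a r).flip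
  let Q' : ℝ → E →L[ℝ] E →L[ℝ] ℝ := fun r ↦
    (g' r ∘L a r + g r ∘L ((1 / 2 : ℝ) • (a r * s r - s r * a r)))
      + (g' r ∘L a r + g r ∘L ((1 / 2 : ℝ) • (a r * s r - s r * a r))).flip
  have hQ (r : ℝ) (hr : 0 ≤ r) : HasDerivWithinAt Q (Q' r) (Ici 0) r := by
    have h1 := (hg r hr).clm_comp (ha r hr)
    exact h1.add ((ContinuousLinearMap.flipₗᵢ ℝ E E ℝ).toContinuousLinearEquiv
      |>.toContinuousLinearMap.hasFDerivAt.comp_hasDerivWithinAt r h1)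
  have hQ0 : Q 0 = 0 := by
    ext v w
    have := h0 v w
    have := hgs 0 le_rfl v (a 0 w)
    simp [Q]
    linarith
  have hb (r : ℝ) (hr : 0 ≤ r) : ‖Q' r‖ ≤ ‖s r‖ * ‖Q r‖ := by
    refine ContinuousLinearMap.opNorm_le_bound₂ _ (by positivity) fun v w ↦ ?_
    have e : Q' r v w = (1 / 2) * (Q r (s r v) w + Q r v (s r w)) := by
      have e1 (v w : E) : g' r v w = g r (s r v) w := by rw [hsg r hr]
      have e2 (v w : E) : g r (s r v) w = g r v (s r w) := by
        rw [hsg r hr, hgs' r hr, hgs r hr v, hsg r hr]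
      have e3 := hgs r hr
      simp only [Q', Q, add_apply, ContinuousLinearMap.comp_apply, ContinuousLinearMap.flip_apply,
        smul_apply, sub_apply, mul_apply_eq_comp, map_smul, map_sub, smul_eq_mul, e1]
      rw [e2 (a r v) w, e2 (a r w) v]
      ring
    have n1 := (Q r).le_opNorm₂ (s r v) w
    have n2 := (Q r).le_opNorm₂ v (s r w)
    have n3 : ‖Q r‖ * ‖s r v‖ * ‖w‖ ≤ ‖Q r‖ * (‖s r‖ * ‖v‖) * ‖w‖ := by
      gcongr; exact (s r).le_opNorm v
    have n4 : ‖Q r‖ * ‖v‖ * ‖s r w‖ ≤ ‖Q r‖ * ‖v‖ * (‖s r‖ * ‖w‖) := by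
      gcongr; exact (s r).le_opNorm w
    have n5 := norm_add_le (Q r (s r v) w) (Q r v (s r w))
    rw [e, norm_mul, Real.norm_of_nonneg (by norm_num)]
    linarith
  have h := DFunLike.congr_fun (DFunLike.congr_fun
    (eq_zero_of_hasDerivWithinAt_Ici hs.norm hQ hQ0 hb ht) v) w
  have h2 := hgs t ht v (a t w)
  simp [Q] at h
  linarith

end Variation

/-! ### Tensor fields in charts -/

section Charts

variable {E : Type*} [NormedAddCommGroup E] [NormedSpace ℝ E]
  {X : Type*} [TopologicalSpace X] [ChartedSpace E X]

theorem extChartAt_symm_mem_source {x : X} {y : E} (hy : y ∈ (extChartAt 𝓘(ℝ, E) x).target) :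
    (extChartAt 𝓘(ℝ, E) x).symm y ∈ (chartAt E x).source := by
  have := (extChartAt 𝓘(ℝ, E) x).map_target hy
  rwa [extChartAt_source] at this

variable [IsManifold 𝓘(ℝ, E) ∞ X]

theorem coframe_frame {x p : X} (hp : p ∈ (chartAt E x).source) (v : E) :
    coframe x p (frame x p v) = v :=
  (trivializationAt E (Tan (E := E) X) x).continuousLinearMapAt_symmL hp v

theorem frame_coframe {x p : X} (hp : p ∈ (chartAt E x).source) (v : Tan (E := E) X p) :
    frame x p (coframe x p v) = v :=
  (trivializationAt E (Tan (E := E) X) x).symmL_continuousLinearMapAt hp v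

/-- The tangent space at x is identified with E through this very chart, so at its centre the matrix
of a tensor is the tensor itself. -/
theorem frame_self (x : X) : frame (E := E) x x = ContinuousLinearMap.id ℝ E := by
  have h := TangentBundle.symmL_trivializationAt_eq_core (I := 𝓘(ℝ, E)) (mem_chart_source E x)
  refine h.trans ?_
  ext v
  exact (tangentBundleCore 𝓘(ℝ, E) X).coordChange_self (achart E x) x (mem_chart_source E x) v

theorem coframe_self (x : X) : coframe (E := E) x x = ContinuousLinearMap.id ℝ E := by
  ext v
  have h := coframe_frame (mem_chart_source E x) v
  rw [frame_self] at h
  exact h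

theorem contMDiffOn_prod_extChartAt_symm (x : X) :
    ContMDiffOn 𝓘(ℝ, ℝ × E) (𝓘(ℝ, ℝ).prod 𝓘(ℝ, E)) ∞
      (fun q : ℝ × E ↦ (q.1, (extChartAt 𝓘(ℝ, E) x).symm q.2))
      (Ici 0 ×ˢ (extChartAt 𝓘(ℝ, E) x).target) := by
  refine ContMDiffOn.prodMk ?_ ?_
  · exact (contDiff_fst (𝕜 := ℝ) (E := ℝ) (F := E)).contMDiff.contMDiffOn
  · exact (contMDiffOn_extChartAt_symm x).comp
      (contDiff_snd (𝕜 := ℝ) (E := ℝ) (F := E)).contMDiff.contMDiffOn (fun q hq ↦ hq.2)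

theorem SmoothEndFamily.contDiffOn {A : ℝ → EndField (E := E) X} (hA : SmoothEndFamily A) (x : X) :
    ContDiffOn ℝ ∞ (fun q : ℝ × E ↦ endInChart (A q.1) x q.2)
      (Ici 0 ×ˢ (extChartAt 𝓘(ℝ, E) x).target) := by
  let e := trivializationAt (E →L[ℝ] E) (fun x ↦ Tan (E := E) X x →L[ℝ] Tan (E := E) X x) x
  have h1 := hA.mono (t := Ici 0 ×ˢ (chartAt E x).source) (prod_mono_right (subset_univ _))
  have h2 := ((e.contMDiffOn_iff (fun q hq ↦ e.mem_source.2 ⟨hq.2, hq.2⟩)).1 h1).2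
  have h3 := h2.comp (contMDiffOn_prod_extChartAt_symm x)
    (fun q hq ↦ ⟨hq.1, extChartAt_symm_mem_source hq.2⟩)
  exact contMDiffOn_iff_contDiffOn.1 h3

theorem trivializationAt_form_apply {x p : X} (hp : p ∈ (chartAt E x).source)
    (v : Tan (E := E) X p →L[ℝ] Tan (E := E) X p →L[ℝ] ℝ) :
    ((trivializationAt (E →L[ℝ] E →L[ℝ] ℝ)
      (fun x ↦ Tan (E := E) X x →L[ℝ] Tan (E := E) X x →L[ℝ] ℝ) x) ⟨p, v⟩).2 =
      (ContinuousLinearMap.precomp ℝ (frame x p)) ∘L v ∘L frame x p := by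
  let e := trivializationAt (E →L[ℝ] ℝ) (fun x ↦ Tan (E := E) X x →L[ℝ] ℝ) x
  have hp' : p ∈ e.baseSet := ⟨hp, trivial⟩
  ext a b
  change (e.continuousLinearMapAt ℝ p (v (frame x p a))) b = v (frame x p a) (frame x p b)
  have h1 : e.continuousLinearMapAt ℝ p (v (frame x p a)) = (e ⟨p, v (frame x p a)⟩).2 :=
    congrFun (e.coe_linearMapAt_of_mem (R := ℝ) hp') (v (frame x p a))
  have h2 : (e ⟨p, v (frame x p a)⟩).2 b = v (frame x p a) (frame x p b) := by
    have h3 : (e ⟨p, v (frame x p a)⟩).2 b = (Bundle.Trivial.trivialization X ℝ).continuousLinearMapAt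
      ℝ p (v (frame x p a) (frame x p b)) := rfl
    rw [h3, Bundle.Trivial.continuousLinearMapAt_trivialization]
    rfl
  exact (DFunLike.congr_fun h1 b).trans h2

theorem SmoothFormFamily.contDiffOn {A : ℝ → FormField (E := E) X} (hA : SmoothFormFamily A)
    (x : X) :
    ContDiffOn ℝ ∞ (fun q : ℝ × E ↦ formInChart (A q.1) x q.2)
      (Ici 0 ×ˢ (extChartAt 𝓘(ℝ, E) x).target) := by
  let e := trivializationAt (E →L[ℝ] E →L[ℝ] ℝ)
    (fun x ↦ Tan (E := E) X x →L[ℝ] Tan (E := E) X x →L[ℝ] ℝ) x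
  have h1 := hA.mono (t := Ici 0 ×ˢ (chartAt E x).source) (prod_mono_right (subset_univ _))
  have h2 := ((e.contMDiffOn_iff (fun q hq ↦ e.mem_source.2 ⟨hq.2, hq.2, trivial⟩)).1 h1).2
  have h3 := h2.comp (contMDiffOn_prod_extChartAt_symm x)
    (fun q hq ↦ ⟨hq.1, extChartAt_symm_mem_source hq.2⟩)
  refine (contMDiffOn_iff_contDiffOn.1 h3).congr fun q hq ↦ ?_
  exact (trivializationAt_form_apply (extChartAt_symm_mem_source hq.2) _).symm

theorem contMDiffOn_prod_extChartAt (x : X) :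
    ContMDiffOn (𝓘(ℝ, ℝ).prod 𝓘(ℝ, E)) 𝓘(ℝ, ℝ × E) ∞
      (fun q : ℝ × X ↦ (q.1, extChartAt 𝓘(ℝ, E) x q.2))
      (Ici 0 ×ˢ (chartAt E x).source) := by
  rw [modelWithCornersSelf_prod, ← chartedSpaceSelf_prod]
  exact contMDiffOn_fst.prodMk (contMDiffOn_extChartAt.comp contMDiffOn_snd (fun q hq ↦ hq.2))

theorem smoothEndFamily_of_contDiffOn {A : ℝ → EndField (E := E) X}
    (hA : ∀ x, ContDiffOn ℝ ∞ (fun q : ℝ × E ↦ endInChart (A q.1) x q.2)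
      (Ici 0 ×ˢ (extChartAt 𝓘(ℝ, E) x).target)) : SmoothEndFamily A := by
  intro q hq
  let e := trivializationAt (E →L[ℝ] E) (fun x ↦ Tan (E := E) X x →L[ℝ] Tan (E := E) X x) q.2
  have hq' : q ∈ Ici (0 : ℝ) ×ˢ (chartAt E q.2).source := ⟨hq.1, mem_chart_source E q.2⟩
  refine ContMDiffWithinAt.mono_of_mem_nhdsWithin
    (s := Ici (0 : ℝ) ×ˢ (chartAt E q.2).source) ?_ ?_
  · refine (e.contMDiffWithinAt_iff (f := fun p : ℝ × X ↦ Bundle.TotalSpace.mk' (E →L[ℝ] E)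
      (E := fun x ↦ Tan (E := E) X x →L[ℝ] Tan (E := E) X x)
      p.2 (A p.1 p.2)) (e.mem_source.2 ⟨hq'.2, hq'.2⟩)).2
      ⟨contMDiffWithinAt_snd, ?_⟩
    have h1 := (contMDiffOn_iff_contDiffOn.2 (hA q.2)).comp (contMDiffOn_prod_extChartAt q.2)
      (fun r hr ↦ ⟨hr.1, (extChartAt 𝓘(ℝ, E) q.2).map_source (by simpa using hr.2)⟩)
    refine (h1.congr fun r hr ↦ ?_) q hq'
    have h2 : (extChartAt 𝓘(ℝ, E) q.2).symm (extChartAt 𝓘(ℝ, E) q.2 r.2) = r.2 :=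
      (extChartAt 𝓘(ℝ, E) q.2).left_inv (by simpa using hr.2)
    simp only [Function.comp_def, endInChart]
    rw [h2]
    rfl
  · rw [nhdsWithin_prod_eq, nhdsWithin_univ]
    exact Filter.prod_mem_prod self_mem_nhdsWithin
      ((chartAt E q.2).open_source.mem_nhds (mem_chart_source E q.2))

theorem smoothFormFamily_of_contDiffOn {A : ℝ → FormField (E := E) X}
    (hA : ∀ x, ContDiffOn ℝ ∞ (fun q : ℝ × E ↦ formInChart (A q.1) x q.2)
      (Ici 0 ×ˢ (extChartAt 𝓘(ℝ, E) x).target)) : SmoothFormFamily A := by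
  intro q hq
  let e := trivializationAt (E →L[ℝ] E →L[ℝ] ℝ)
    (fun x ↦ Tan (E := E) X x →L[ℝ] Tan (E := E) X x →L[ℝ] ℝ) q.2
  have hq' : q ∈ Ici (0 : ℝ) ×ˢ (chartAt E q.2).source := ⟨hq.1, mem_chart_source E q.2⟩
  refine ContMDiffWithinAt.mono_of_mem_nhdsWithin
    (s := Ici (0 : ℝ) ×ˢ (chartAt E q.2).source) ?_ ?_
  · refine (e.contMDiffWithinAt_iff (f := fun p : ℝ × X ↦ Bundle.TotalSpace.mk' (E →L[ℝ] E →L[ℝ] ℝ)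
      (E := fun x ↦ Tan (E := E) X x →L[ℝ] Tan (E := E) X x →L[ℝ] ℝ)
      p.2 (A p.1 p.2)) (e.mem_source.2 ⟨hq'.2, hq'.2, trivial⟩)).2
      ⟨contMDiffWithinAt_snd, ?_⟩
    have h1 := (contMDiffOn_iff_contDiffOn.2 (hA q.2)).comp (contMDiffOn_prod_extChartAt q.2)
      (fun r hr ↦ ⟨hr.1, (extChartAt 𝓘(ℝ, E) q.2).map_source (by simpa using hr.2)⟩)
    refine (h1.congr fun r hr ↦ ?_) q hq'
    have h2 : (extChartAt 𝓘(ℝ, E) q.2).symm (extChartAt 𝓘(ℝ, E) q.2 r.2) = r.2 :=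
      (extChartAt 𝓘(ℝ, E) q.2).left_inv (by simpa using hr.2)
    simp only [Function.comp_def, formInChart]
    rw [h2]
    exact trivializationAt_form_apply hr.2 _
  · rw [nhdsWithin_prod_eq, nhdsWithin_univ]
    exact Filter.prod_mem_prod self_mem_nhdsWithin
      ((chartAt E q.2).open_source.mem_nhds (mem_chart_source E q.2))

theorem smoothEnd_iff {A : EndField (E := E) X} : SmoothEnd A ↔ SmoothEndFamily fun _ ↦ A :=
  ⟨fun h ↦ (h.comp contMDiff_snd).contMDiffOn, fun h ↦ h.comp_contMDiff
    ((contMDiff_const (c := (0 : ℝ))).prodMk contMDiff_id)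
      fun _ ↦ ⟨self_mem_Ici, trivial⟩⟩

theorem smoothForm_iff {A : FormField (E := E) X} : SmoothForm A ↔ SmoothFormFamily fun _ ↦ A :=
  ⟨fun h ↦ (h.comp contMDiff_snd).contMDiffOn, fun h ↦ h.comp_contMDiff
    ((contMDiff_const (c := (0 : ℝ))).prodMk contMDiff_id)
      fun _ ↦ ⟨self_mem_Ici, trivial⟩⟩

end Charts

theorem isInvertible_of_pos {E : Type*} [NormedAddCommGroup E] [NormedSpace ℝ E]
    [FiniteDimensional ℝ E] {B : E →L[ℝ] E →L[ℝ] ℝ} (hB : ∀ v, v ≠ 0 → 0 < B v v) :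
    B.IsInvertible := by
  have hinj : Function.Injective (B : E →ₗ[ℝ] E →L[ℝ] ℝ) := by
    rw [← LinearMap.ker_eq_bot, LinearMap.ker_eq_bot']
    intro v hv
    by_contra hne
    have := hB v hne
    have h0 : B v = 0 := hv
    rw [h0] at this
    exact lt_irrefl _ this
  have hdim : Module.finrank ℝ E = Module.finrank ℝ (E →L[ℝ] ℝ) := by
    rw [← (LinearMap.toContinuousLinearMap (𝕜 := ℝ) (E := E) (F' := ℝ)).finrank_eq]
    exact (Subspace.dual_finrank_eq (K := ℝ) (V := E)).symm
  exact ⟨(LinearEquiv.ofInjectiveOfFinrankEq _ hinj hdim).toContinuousLinearEquiv, by ext; rfl⟩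

/-! ### Metric, sharp and time derivatives in charts -/

section Charts

variable {E : Type*} [NormedAddCommGroup E] [NormedSpace ℝ E]
  {X : Type*} [TopologicalSpace X] [ChartedSpace E X] [IsManifold 𝓘(ℝ, E) ∞ X]

theorem formInChart_apply (v : FormField (E := E) X) (x : X) (y u w : E) :
    formInChart v x y u w = v ((extChartAt 𝓘(ℝ, E) x).symm y)
      (frame x ((extChartAt 𝓘(ℝ, E) x).symm y) u) (frame x ((extChartAt 𝓘(ℝ, E) x).symm y) w) := rfl

theorem endInChart_apply (A : EndField (E := E) X) (x : X) (y u : E) :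
    endInChart A x y u = coframe x ((extChartAt 𝓘(ℝ, E) x).symm y)
      (A ((extChartAt 𝓘(ℝ, E) x).symm y) (frame x ((extChartAt 𝓘(ℝ, E) x).symm y) u)) := rfl

theorem formInChart_self (v : FormField (E := E) X) (x : X) :
    formInChart v x (extChartAt 𝓘(ℝ, E) x x) = v x := by
  ext u w
  rw [formInChart_apply, extChartAt_to_inv, frame_self]
  rfl

theorem endInChart_self (A : EndField (E := E) X) (x : X) :
    endInChart A x (extChartAt 𝓘(ℝ, E) x x) = A x := by
  ext u
  rw [endInChart_apply, extChartAt_to_inv, frame_self, coframe_self]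
  rfl

theorem formInChart_symm {v : FormField (E := E) X} (hv : ∀ x ξ η, v x ξ η = v x η ξ) (x : X)
    (y u w : E) : formInChart v x y u w = formInChart v x y w u := hv _ _ _

theorem Metric.formInChart_isInvertible [FiniteDimensional ℝ E] (g : Metric (E := E) X) {x : X}
    {y : E} (hy : y ∈ (extChartAt 𝓘(ℝ, E) x).target) :
    (formInChart g.inner x y).IsInvertible := by
  refine isInvertible_of_pos fun v hv ↦ g.pos _ _ fun h ↦ hv ?_
  exact (coframe_frame (extChartAt_symm_mem_source hy) v).symm.trans
    ((congrArg _ h).trans (map_zero _))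

theorem Metric.inner_sharp [FiniteDimensional ℝ E] (g : Metric (E := E) X)
    (v : FormField (E := E) X) (x : X) (ξ : Tan (E := E) X x) :
    g.inner x (sharp g.inner v x ξ) = v x ξ := by
  have h := g.formInChart_isInvertible (mem_extChartAt_target (I := 𝓘(ℝ, E)) x)
  rw [formInChart_self] at h
  exact h.self_apply_inverse (v x ξ)

theorem Metric.inner_transpose [FiniteDimensional ℝ E] (g : Metric (E := E) X) (x : X)
    (A : Tan (E := E) X x →L[ℝ] Tan (E := E) X x) (ξ η : Tan (E := E) X x) :
    g.inner x (transpose g.inner x A ξ) η = g.inner x ξ (A η) := by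
  have h := g.formInChart_isInvertible (mem_extChartAt_target (I := 𝓘(ℝ, E)) x)
  rw [formInChart_self] at h
  exact DFunLike.congr_fun
    (h.self_apply_inverse ((ContinuousLinearMap.precomp ℝ A) (g.inner x ξ))) η

theorem Metric.formInChart_sharp [FiniteDimensional ℝ E] (g : Metric (E := E) X)
    (v : FormField (E := E) X) {x : X} {y : E} (hy : y ∈ (extChartAt 𝓘(ℝ, E) x).target) (u : E) :
    formInChart g.inner x y (endInChart (sharp g.inner v) x y u) = formInChart v x y u := by
  ext w
  rw [formInChart_apply, endInChart_apply, frame_coframe (extChartAt_symm_mem_source hy),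
    g.inner_sharp]
  rfl

/-- The frame does not depend on time. As `timeDeriv` is a `derivWithin`, differentiability is first
carried back to the fibre by the coframe. -/
theorem hasDerivWithinAt_formInChart {v : ℝ → FormField (E := E) X} {x : X} {y : E} {t : ℝ}
    (hy : y ∈ (extChartAt 𝓘(ℝ, E) x).target) (ht : 0 ≤ t)
    (hv : DifferentiableWithinAt ℝ (fun s ↦ formInChart (v s) x y) (Ici 0) t) :
    HasDerivWithinAt (fun s ↦ formInChart (v s) x y) (formInChart (timeDeriv v t) x y)
      (Ici 0) t := by
  set p := (extChartAt 𝓘(ℝ, E) x).symm y with hp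
  let a : E →L[ℝ] E := frame x p
  let b : E →L[ℝ] E := coframe x p
  have hab (u : E) : a (b u) = u := frame_coframe (extChartAt_symm_mem_source hy) u
  have hba (u : E) : b (a u) = u := coframe_frame (extChartAt_symm_mem_source hy) u
  have h1 := hv.hasDerivWithinAt
  set c := derivWithin (fun s ↦ formInChart (v s) x y) (Ici 0) t
  have h2 := ((hasDerivWithinAt_const t (Ici 0) (ContinuousLinearMap.precomp ℝ b)).clm_comp
    h1).clm_comp (hasDerivWithinAt_const t (Ici 0) b)
  let V : ℝ → E →L[ℝ] E →L[ℝ] ℝ := fun s ↦ v s p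
  have h3 : HasDerivWithinAt V ((ContinuousLinearMap.precomp ℝ b) ∘L c ∘L b) (Ici 0) t := by
    refine (h2.congr_deriv (by ext; simp)).congr_of_mem (fun s hs ↦ ?_) ht
    ext u w
    change V s u w = V s (a (b u)) (a (b w))
    rw [hab, hab]
  have h4 : timeDeriv v t p = (ContinuousLinearMap.precomp ℝ b) ∘L c ∘L b := by
    have h : timeDeriv v t p = derivWithin V (Ici 0) t := rfl
    exact h.trans (h3.derivWithin (uniqueDiffOn_Ici 0 t ht))
  have h5 : formInChart (timeDeriv v t) x y = c := by
    ext u w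
    rw [formInChart_apply, ← hp, h4]
    change c (b (a u)) (b (a w)) = c u w
    rw [hba, hba]
  rwa [h5]

theorem hasDerivWithinAt_endInChart {J : ℝ → EndField (E := E) X} {g : ℝ → Metric (E := E) X}
    (hJ : SolvesODE J g) {x : X} {y : E} {t : ℝ} (hy : y ∈ (extChartAt 𝓘(ℝ, E) x).target)
    (ht : 0 ≤ t) :
    HasDerivWithinAt (fun s ↦ endInChart (J s) x y)
      ((1 / 2 : ℝ) • (endInChart (J t) x y
        * endInChart (sharp (g t).inner (timeDeriv (fun s ↦ (g s).inner) t)) x y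
        - endInChart (sharp (g t).inner (timeDeriv (fun s ↦ (g s).inner) t)) x y
        * endInChart (J t) x y)) (Ici 0) t := by
  set p := (extChartAt 𝓘(ℝ, E) x).symm y with hp
  let a : E →L[ℝ] E := frame x p
  let b : E →L[ℝ] E := coframe x p
  have hab (u : E) : a (b u) = u := frame_coframe (extChartAt_symm_mem_source hy) u
  set S := sharp (g t).inner (timeDeriv (fun s ↦ (g s).inner) t)
  let j : ℝ → E →L[ℝ] E := fun s ↦ J s p
  let σ : E →L[ℝ] E := S p
  have h1 : HasDerivWithinAt j ((1 / 2 : ℝ) • (j t * σ - σ * j t)) (Ici 0) t := hJ t ht p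
  have h2 := ((hasDerivWithinAt_const t (Ici 0) b).clm_comp
    (h1.clm_comp (hasDerivWithinAt_const t (Ici 0) a)))
  refine h2.congr_deriv ?_
  ext u
  simp only [ContinuousLinearMap.zero_comp, ContinuousLinearMap.comp_zero, add_zero, zero_add]
  change b ((1 / 2 : ℝ) • (j t (σ (a u)) - σ (j t (a u)))) =
    (1 / 2 : ℝ) • (b (j t (a (b (σ (a u))))) - b (σ (a (b (j t (a u))))))
  rw [hab, hab, map_smul, map_sub]

theorem nabla_eq_covariantDeriv (g : FormField (E := E) X) (A : EndField (E := E) X) (x : X) :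
    nabla g A x = covariantDeriv (formInChart g x) (endInChart A x) (extChartAt 𝓘(ℝ, E) x x) := by
  rw [covariantDeriv, endInChart_self]
  let a : E →L[ℝ] E := A x
  set Γ := christoffel (formInChart g x) (extChartAt 𝓘(ℝ, E) x x)
  set D := fderiv ℝ (endInChart A x) (extChartAt 𝓘(ℝ, E) x x) with hD
  ext u v
  change D u v + Γ u (a v) - a (Γ u v) = D u v - (a (Γ u v) - Γ u (a v))
  exact (sub_sub_eq_add_sub _ _ _).symm

end Charts

/-! ### From dJ = [J, Γ] to the variation identity and back -/

section Evolution

variable {E : Type*} [NormedAddCommGroup E] [NormedSpace ℝ E]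
  {Γ : ℝ × E → E →L[ℝ] E →L[ℝ] E} {S J : ℝ × E → E →L[ℝ] E} {U : Set E} {t : ℝ} {y : E}

theorem fderiv_half_smul_commutator {a s : E → E →L[ℝ] E} {a' s' : E →L[ℝ] E →L[ℝ] E}
    (ha : HasFDerivAt a a' y) (hs : HasFDerivAt s s' y) (u : E) :
    fderiv ℝ (fun z ↦ (1 / 2 : ℝ) • (a z * s z - s z * a z)) y u =
      (1 / 2 : ℝ) • (a' u * s y - s y * a' u + (a y * s' u - s' u * a y)) := by
  have h := (((ha.mul' hs).sub (hs.mul' ha)).const_smul (1 / 2 : ℝ)).fderiv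
  refine (DFunLike.congr_fun h u).trans ?_
  simp only [smul_apply, sub_apply, add_apply, MulOpposite.smul_eq_mul_unop, smul_eq_mul,
    MulOpposite.unop_op]
  congr 1
  abel

/-- The mixed derivative of J is computed twice: from dJ = [J, Γ] by differentiating in time, and
from the ODE by differentiating in space. -/
theorem commutatorForm_derivWithin_of_fderiv_eq (hU : IsOpen U)
    (hΓ : ContDiffOn ℝ ∞ Γ (Ici (0 : ℝ) ×ˢ U)) (hS : ContDiffOn ℝ ∞ S (Ici (0 : ℝ) ×ˢ U))
    (hJs : ContDiffOn ℝ ∞ J (Ici (0 : ℝ) ×ˢ U)) (hy : y ∈ U)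
    (hJ : ∀ s, 0 ≤ s → ∀ z ∈ U, HasDerivWithinAt (fun r ↦ J (r, z))
      ((1 / 2 : ℝ) • (J (s, z) * S (s, z) - S (s, z) * J (s, z))) (Ici 0) s)
    (h : ∀ s, 0 ≤ s → fderiv ℝ (fun z ↦ J (s, z)) y = commutatorForm (J (s, y)) (Γ (s, y)))
    (ht : 0 ≤ t) :
    commutatorForm (J (t, y)) (derivWithin (fun s ↦ Γ (s, y)) (Ici 0) t) =
      (1 / 2 : ℝ) • commutatorForm (J (t, y))
        (fderiv ℝ (fun z ↦ S (t, z)) y - commutatorForm (S (t, y)) (Γ (t, y))) := by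
  have hq : (t, y) ∈ Ici (0 : ℝ) ×ˢ U := ⟨ht, hy⟩
  rw [← commutatorForm_eq_iff_linearisation]
  intro u
  have h1 := hasDerivWithinAt_fderiv_slice hU hJs ht hy
  have dΓ := hasDerivWithinAt_slice ((hΓ.differentiableOn (by simp)) _ hq).hasFDerivWithinAt hy
  rw [← derivWithin_slice hΓ ht hy] at dΓ
  have h2 := (hasDerivWithinAt_commutatorForm (hJ t ht y hy) dΓ).congr_of_mem
    (fun s hs ↦ h s hs) ht
  rw [(uniqueDiffOn_Ici 0 t ht).eq_deriv _ h2 h1, ← h t ht]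
  have h3 : (fun z ↦ derivWithin (fun s ↦ J (s, z)) (Ici 0) t) =ᶠ[𝓝 y]
      fun z ↦ (1 / 2 : ℝ) • (J (t, z) * S (t, z) - S (t, z) * J (t, z)) :=
    (hU.eventually_mem hy).mono fun z hz ↦
      (hJ t ht z hz).derivWithin (uniqueDiffOn_Ici 0 t ht)
  rw [h3.fderiv_eq]
  have dJ := hasFDerivAt_slice hU ((hJs.differentiableOn (by simp)) _ hq).hasFDerivWithinAt ht hy
  have dS := hasFDerivAt_slice hU ((hS.differentiableOn (by simp)) _ hq).hasFDerivWithinAt ht hy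
  exact fderiv_half_smul_commutator dJ.differentiableAt.hasFDerivAt
    dS.differentiableAt.hasFDerivAt u

/-- The candidate [J, Γ] involves J only along the single point y, so it is differentiable in time
by the ODE; spatial differentiability of J is needed only at time 0. -/
theorem hasFDerivWithinAt_of_commutatorForm_derivWithin (hU : IsOpen U)
    (hΓ : ContDiffOn ℝ ∞ Γ (Ici (0 : ℝ) ×ˢ U)) (hS : ContDiffOn ℝ ∞ S (Ici (0 : ℝ) ×ˢ U))
    (hy : y ∈ U)
    (hJ : ∀ s, 0 ≤ s → ∀ z ∈ U, HasDerivWithinAt (fun r ↦ J (r, z))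
      ((1 / 2 : ℝ) • (J (s, z) * S (s, z) - S (s, z) * J (s, z))) (Ici 0) s)
    (h0 : HasFDerivAt (fun z ↦ J (0, z)) (commutatorForm (J (0, y)) (Γ (0, y))) y)
    (h : ∀ s, 0 ≤ s → commutatorForm (J (s, y)) (derivWithin (fun r ↦ Γ (r, y)) (Ici 0) s) =
      (1 / 2 : ℝ) • commutatorForm (J (s, y))
        (fderiv ℝ (fun z ↦ S (s, z)) y - commutatorForm (S (s, y)) (Γ (s, y))))
    (ht : 0 ≤ t) :
    HasFDerivWithinAt J
      ((ContinuousLinearMap.fst ℝ ℝ E).smulRight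
        ((1 / 2 : ℝ) • (J (t, y) * S (t, y) - S (t, y) * J (t, y)))
        + commutatorForm (J (t, y)) (Γ (t, y)) ∘L ContinuousLinearMap.snd ℝ ℝ E)
      (Ici 0 ×ˢ U) (t, y) := by
  refine hasFDerivWithinAt_of_commutator_ode (B := fun s ↦ commutatorForm (J (s, y)) (Γ (s, y)))
    hU hS hy hJ (fun s hs ↦ ?_) (fun s hs ↦ commutatorForm_eq_iff_linearisation.2 (h s hs)) h0 ht
  have dΓ := hasDerivWithinAt_slice
    ((hΓ.differentiableOn (by simp)) (s, y) ⟨hs, hy⟩).hasFDerivWithinAt hy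
  rw [← derivWithin_slice hΓ hs hy] at dΓ
  exact hasDerivWithinAt_commutatorForm (hJ s hs y hy) dΓ

/-- Bootstrapping: the differential of J is polynomial in J, S and Γ, so J of class C^n implies
class C^(n+1). -/
theorem contDiffOn_of_hasFDerivWithinAt_commutator (hU : IsOpen U)
    (hΓ : ContDiffOn ℝ ∞ Γ (Ici (0 : ℝ) ×ˢ U)) (hS : ContDiffOn ℝ ∞ S (Ici (0 : ℝ) ×ˢ U))
    (h : ∀ q ∈ Ici (0 : ℝ) ×ˢ U, HasFDerivWithinAt J
      ((ContinuousLinearMap.fst ℝ ℝ E).smulRight ((1 / 2 : ℝ) • (J q * S q - S q * J q))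
        + commutatorForm (J q) (Γ q) ∘L ContinuousLinearMap.snd ℝ ℝ E) (Ici 0 ×ˢ U) q) :
    ContDiffOn ℝ ∞ J (Ici (0 : ℝ) ×ˢ U) := by
  refine contDiffOn_infty.2 fun n ↦ ?_
  induction n with
  | zero => exact contDiffOn_zero.2 fun q hq ↦ (h q hq).continuousWithinAt
  | succ n ih =>
    have hS' := hS.of_le (m := n) (by exact_mod_cast le_top)
    have hΓ' := hΓ.of_le (m := n) (by exact_mod_cast le_top)
    refine (contDiffOn_succ_iff_hasFDerivWithinAt_of_uniqueDiffOn (uniqueDiffOn_Ici_prod hU)).2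
      ⟨fun h ↦ (WithTop.coe_ne_top (a := (n : ℕ∞)) h).elim, _, ?_, h⟩
    refine ContDiffOn.add ?_ ?_
    · exact contDiffOn_const.smulRight (((ih.mul hS').sub (hS'.mul ih)).const_smul _)
    · refine ContDiffOn.clm_comp ?_ contDiffOn_const
      exact ((((ContinuousLinearMap.compL ℝ E E E).contDiff).comp_contDiffOn ih).clm_comp hΓ').sub
        ((((ContinuousLinearMap.compL ℝ E E E).flip.contDiff).comp_contDiffOn ih).clm_comp hΓ')

end Evolution

/-! ### Covariance under changes of coordinates -/

section ChartChange

variable {E : Type*} [NormedAddCommGroup E] [NormedSpace ℝ E]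
  {G₁ G₂ : E → E →L[ℝ] E →L[ℝ] ℝ} {τ : E → E} {φ : E → E →L[ℝ] E} {ψ : E → E →L[ℝ] E} {y : E}

/-- The transformation law of the Christoffel symbols. -/
theorem christoffel_change (hτ : ContDiffAt ℝ ∞ τ y) (hφ : φ =ᶠ[𝓝 y] fderiv ℝ τ)
    (hφψ : ∀ u, φ y (ψ y u) = u)
    (hG₁ : (G₁ y).IsInvertible) (hG₂ : (G₂ (τ y)).IsInvertible)
    (hd : DifferentiableAt ℝ G₂ (τ y)) (hs : ∀ᶠ z in 𝓝 (τ y), ∀ v w, G₂ z v w = G₂ z w v)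
    (hG : ∀ᶠ z in 𝓝 y, ∀ v w, G₁ z v w = G₂ (τ z) (φ z v) (φ z w)) (u v : E) :
    φ y (christoffel G₁ y u v) =
      christoffel G₂ (τ y) (φ y u) (φ y v) + fderiv ℝ φ y u v := by
  have hφd : DifferentiableAt ℝ φ y := by
    have h1 : ContDiffAt ℝ ∞ (fderiv ℝ τ) y := hτ.fderiv_right (by simp)
    exact (h1.differentiableAt (by simp)).congr_of_eventuallyEq hφ
  have hφs (u v : E) : fderiv ℝ φ y u v = fderiv ℝ φ y v u := by
    rw [hφ.fderiv_eq]
    exact (hτ.isSymmSndFDerivAt (by simpa using ENat.LEInfty.out)) u v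
  have hτd : HasFDerivAt τ (φ y) y := by
    rw [hφ.self_of_nhds]
    exact (hτ.differentiableAt (by simp)).hasFDerivAt
  have hsymm₂ := hs.self_of_nhds
  have hΓ := fun u v ↦ christoffel_symm hG₂ hd hs u v
  have hG₁d : DifferentiableAt ℝ G₁ y := by
    have h1 : DifferentiableAt ℝ (fun z ↦ (ContinuousLinearMap.compL ℝ E E ℝ).flip (φ z) ∘L
        G₂ (τ z) ∘L φ z) y := by
      have h2 := ((ContinuousLinearMap.compL ℝ E E ℝ).flip.differentiableAt).comp y hφd
      have h3 : DifferentiableAt ℝ (fun z ↦ G₂ (τ z)) y := hd.comp y hτd.differentiableAt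
      exact h2.clm_comp (h3.clm_comp hφd)
    refine h1.congr_of_eventuallyEq (hG.mono fun z hz ↦ ?_)
    ext v w
    exact hz v w
  -- The pulled-back symbols are torsion-free, as dφ is the second derivative of τ, and compatible
  -- with G₁; uniqueness of the Levi-Civita connection identifies them.
  have key : ∀ u v, ψ y (christoffel G₂ (τ y) (φ y u) (φ y v) + fderiv ℝ φ y u v) =
      christoffel G₁ y u v := by
    refine eq_christoffel hG₁ (fun v w ↦ ?_) (fun u v ↦ ?_) (fun u v w ↦ ?_)
    · rw [hG.self_of_nhds, hG.self_of_nhds, hsymm₂]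
    · rw [hΓ, hφs]
    · rw [hG.self_of_nhds, hG.self_of_nhds, hφψ, hφψ]
      have k (a : E) : HasFDerivAt (fun _ : E ↦ a) (0 : E →L[ℝ] E) y := hasFDerivAt_const _ _
      have h1 := (hG₁d.hasFDerivAt.clm_apply (k v)).clm_apply (k w)
      have h2 := ((hd.hasFDerivAt.comp y hτd).clm_apply
        (hφd.hasFDerivAt.clm_apply (k v))).clm_apply (hφd.hasFDerivAt.clm_apply (k w))
      have h3 : (fun z ↦ G₁ z v w) =ᶠ[𝓝 y] fun z ↦ G₂ (τ z) (φ z v) (φ z w) :=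
        hG.mono fun z hz ↦ hz v w
      have h4 := DFunLike.congr_fun (h1.unique (h2.congr_of_eventuallyEq h3)) u
      simp at h4
      rw [h4, fderiv_eq_christoffel hG₂ hd hs]
      simp only [map_add, add_apply]
      ring
  rw [← key, hφψ]

/-- Under conjugation J₁ = ψJ₂φ with ψ = φ⁻¹, the derivatives of φ and ψ produce exactly the
commutator with the inhomogeneous term of the transformation law of Γ. -/
theorem hasFDerivWithinAt_change {J₁ J₂ : ℝ × E → E →L[ℝ] E} {c c₂ : E →L[ℝ] E}
    {Γ₁ Γ₂ : E →L[ℝ] E →L[ℝ] E} {V W : Set E} {t : ℝ} (ht : 0 ≤ t) (hW : IsOpen W) (hy : y ∈ W)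
    (hτW : MapsTo τ W V) (hτ : HasFDerivAt τ (φ y) y)
    (hφ : DifferentiableAt ℝ φ y) (hψ : DifferentiableAt ℝ ψ y)
    (hψφ : ∀ z ∈ W, ψ z * φ z = 1) (hφψ : ∀ z ∈ W, φ z * ψ z = 1)
    (hΓ : ∀ u, φ y * Γ₁ u = Γ₂ (φ y u) * φ y + fderiv ℝ φ y u)
    (hJ : ∀ s, ∀ z ∈ W, J₁ (s, z) = ψ z * (J₂ (s, τ z) * φ z))
    (hc : HasDerivWithinAt (fun s ↦ J₁ (s, y)) c (Ici 0) t)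
    (h : HasFDerivWithinAt J₂ ((ContinuousLinearMap.fst ℝ ℝ E).smulRight c₂
        + commutatorForm (J₂ (t, τ y)) Γ₂ ∘L ContinuousLinearMap.snd ℝ ℝ E)
      (Ici 0 ×ˢ V) (t, τ y)) :
    HasFDerivWithinAt J₁ ((ContinuousLinearMap.fst ℝ ℝ E).smulRight c
        + commutatorForm (J₁ (t, y)) Γ₁ ∘L ContinuousLinearMap.snd ℝ ℝ E)
      (Ici 0 ×ˢ W) (t, y) := by
  have hq : (t, y) ∈ Ici (0 : ℝ) ×ˢ W := ⟨ht, hy⟩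
  have hsnd : HasFDerivWithinAt Prod.snd (ContinuousLinearMap.snd ℝ ℝ E) (Ici (0 : ℝ) ×ˢ W)
      (t, y) := hasFDerivWithinAt_snd
  have h1 : HasFDerivWithinAt (fun q : ℝ × E ↦ (q.1, τ q.2))
      ((ContinuousLinearMap.fst ℝ ℝ E).prod (φ y ∘L ContinuousLinearMap.snd ℝ ℝ E))
      (Ici 0 ×ˢ W) (t, y) :=
    hasFDerivWithinAt_fst.prodMk (HasFDerivAt.comp_hasFDerivWithinAt (t, y) hτ hsnd)
  have h2 := HasFDerivWithinAt.comp (f := fun q : ℝ × E ↦ (q.1, τ q.2)) (t, y) h h1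
    (fun q hq ↦ ⟨hq.1, hτW hq.2⟩)
  have h3 := HasFDerivAt.comp_hasFDerivWithinAt (t, y) hφ.hasFDerivAt hsnd
  have h4 := HasFDerivAt.comp_hasFDerivWithinAt (t, y) hψ.hasFDerivAt hsnd
  have h5 := (h4.mul' (h2.mul' h3)).congr (fun q hq ↦ hJ q.1 q.2 hq.2) (hJ t y hy)
  refine h5.congr_fderiv ?_
  -- The time component needs no computation: uniqueness of the one-sided derivative of the time
  -- slice identifies it with c.
  have h6 := (uniqueDiffOn_Ici 0 t ht).eq_deriv _ (hasDerivWithinAt_slice h5 hy) hc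
  have h7 (u : E) : fderiv ℝ ψ y u = - (ψ y * fderiv ℝ φ y u * ψ y) := by
    have h8 : (fun z ↦ ψ z * φ z) =ᶠ[𝓝 y] fun _ ↦ 1 :=
      (hW.eventually_mem hy).mono hψφ
    have h9 := DFunLike.congr_fun ((hψ.hasFDerivAt.mul' hφ.hasFDerivAt).unique
      ((hasFDerivAt_const (1 : E →L[ℝ] E) y).congr_of_eventuallyEq h8)) u
    have h10 : ψ y * fderiv ℝ φ y u + fderiv ℝ ψ y u * φ y = 0 := h9
    calc fderiv ℝ ψ y u = fderiv ℝ ψ y u * (φ y * ψ y) := by rw [hφψ y hy, mul_one]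
      _ = (ψ y * fderiv ℝ φ y u + fderiv ℝ ψ y u * φ y) * ψ y - ψ y * fderiv ℝ φ y u * ψ y := by
        noncomm_ring
      _ = _ := by rw [h10, zero_mul, zero_sub]
  set L := ψ y • (J₂ (t, τ y) • fderiv ℝ φ y ∘L ContinuousLinearMap.snd ℝ ℝ E +
    MulOpposite.op (φ y) • ((ContinuousLinearMap.fst ℝ ℝ E).smulRight c₂ +
      commutatorForm (J₂ (t, τ y)) Γ₂ ∘L ContinuousLinearMap.snd ℝ ℝ E) ∘L
      (ContinuousLinearMap.fst ℝ ℝ E).prod (φ y ∘L ContinuousLinearMap.snd ℝ ℝ E)) +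
    MulOpposite.op (J₂ (t, τ y) * φ y) • fderiv ℝ ψ y ∘L ContinuousLinearMap.snd ℝ ℝ E
  change L (1, 0) = c at h6
  change L = _
  refine ContinuousLinearMap.ext fun q ↦ ?_
  obtain ⟨s, u⟩ := q
  have h8 : L (0, u) = ψ y * (J₂ (t, τ y) * fderiv ℝ φ y u
      + (J₂ (t, τ y) * Γ₂ (φ y u) - Γ₂ (φ y u) * J₂ (t, τ y)) * φ y)
      + fderiv ℝ ψ y u * (J₂ (t, τ y) * φ y) := by
    have : L (0, u) = ψ y * (J₂ (t, τ y) * fderiv ℝ φ y u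
      + ((0 : ℝ) • c₂ + (J₂ (t, τ y) * Γ₂ (φ y u) - Γ₂ (φ y u) * J₂ (t, τ y))) * φ y)
      + fderiv ℝ ψ y u * (J₂ (t, τ y) * φ y) := rfl
    rw [this, zero_smul, zero_add]
  have h9 : L (s, u) = s • L (1, 0) + L (0, u) := by
    rw [← map_smul, ← map_add]
    simp
  have h10 : Γ₁ u = ψ y * (Γ₂ (φ y u) * φ y + fderiv ℝ φ y u) := by
    rw [← hΓ, ← mul_assoc, hψφ y hy, one_mul]
  have h11 : ((ContinuousLinearMap.fst ℝ ℝ E).smulRight c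
      + commutatorForm (J₁ (t, y)) Γ₁ ∘L ContinuousLinearMap.snd ℝ ℝ E) (s, u)
      = s • c + (J₁ (t, y) * Γ₁ u - Γ₁ u * J₁ (t, y)) := rfl
  rw [h11, h9, h6, h8, h7, hJ t y hy, h10]
  congr 1
  -- The factors 1 mark the places where φψ is inserted; afterwards both sides agree as
  -- noncommutative polynomials.
  calc _ = ψ y * (J₂ (t, τ y) * (1 * (Γ₂ (φ y u) * φ y + fderiv ℝ φ y u)))
      - ψ y * (Γ₂ (φ y u) * (1 * (J₂ (t, τ y) * φ y)) + fderiv ℝ φ y u * ψ y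
        * (J₂ (t, τ y) * φ y)) := by noncomm_ring
    _ = _ := by rw [← hφψ y hy]; noncomm_ring

end ChartChange

/-! ### Transition maps and their Jacobians -/

section Transition

variable {E : Type*} [NormedAddCommGroup E] [NormedSpace ℝ E]
  {X : Type*} [TopologicalSpace X] [ChartedSpace E X]

/-- The domain, in the chart around `x`, of the change of coordinates to the chart around `p`. -/
def overlap (x p : X) : Set E :=
  (extChartAt 𝓘(ℝ, E) x).target ∩ (extChartAt 𝓘(ℝ, E) x).symm ⁻¹' (extChartAt 𝓘(ℝ, E) p).source

/-- The change of coordinates from the chart around `x` to the chart around `p`. -/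
def transition (x p : X) (z : E) : E := extChartAt 𝓘(ℝ, E) p ((extChartAt 𝓘(ℝ, E) x).symm z)

theorem isOpen_overlap (x p : X) : IsOpen (overlap (E := E) x p) :=
  (continuousOn_extChartAt_symm x).isOpen_inter_preimage (isOpen_extChartAt_target x)
    (isOpen_extChartAt_source p)

theorem transition_symm {x p : X} {z : E} (hz : z ∈ overlap x p) :
    (extChartAt 𝓘(ℝ, E) p).symm (transition x p z) = (extChartAt 𝓘(ℝ, E) x).symm z :=
  (extChartAt 𝓘(ℝ, E) p).left_inv hz.2

theorem transition_mem_overlap {x p : X} {z : E} (hz : z ∈ overlap x p) :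
    transition x p z ∈ overlap p x := by
  refine ⟨(extChartAt 𝓘(ℝ, E) p).map_source hz.2, ?_⟩
  rw [mem_preimage, transition_symm hz]
  exact (extChartAt 𝓘(ℝ, E) x).map_target hz.1

theorem mem_chartAt_source_of_mem_overlap {x p : X} {z : E} (hz : z ∈ overlap x p) :
    (extChartAt 𝓘(ℝ, E) x).symm z ∈ (chartAt E p).source := by
  have := hz.2
  rwa [mem_preimage, extChartAt_source] at this

variable [IsManifold 𝓘(ℝ, E) ∞ X]

/-- The Jacobian matrix of `transition x p`. -/
def jacobian (x p : X) (z : E) : E →L[ℝ] E :=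
  (coframe p ((extChartAt 𝓘(ℝ, E) x).symm z)).comp (frame x ((extChartAt 𝓘(ℝ, E) x).symm z))

theorem contDiffAt_transition {x p : X} {z : E} (hz : z ∈ overlap x p) :
    ContDiffAt ℝ ∞ (transition x p) z := by
  have h := contDiffWithinAt_ext_coord_change (I := 𝓘(ℝ, E)) (n := ∞) p x (y := z)
    (by rw [PartialEquiv.trans_source]; exact hz)
  rw [modelWithCornersSelf_coe, range_id] at h
  exact h

theorem hasFDerivAt_transition {x p : X} {z : E} (hz : z ∈ overlap x p) :
    HasFDerivAt (transition x p) (jacobian x p z) z := by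
  have hx := (extChartAt 𝓘(ℝ, E) x).map_target hz.1
  have hx' := extChartAt_symm_mem_source hz.1
  have hp' := mem_chartAt_source_of_mem_overlap hz
  have h := hasFDerivWithinAt_tangentCoordChange (I := 𝓘(ℝ, E)) (x := x) (y := p)
    (z := (extChartAt 𝓘(ℝ, E) x).symm z) ⟨hx, hz.2⟩
  rw [(extChartAt 𝓘(ℝ, E) x).right_inv hz.1, modelWithCornersSelf_coe, range_id,
    hasFDerivWithinAt_univ] at h
  -- Frame and coframe both pass through the preferred chart at the point itself; the cocycle
  -- identity removes this intermediate chart.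
  have e : jacobian x p z = tangentCoordChange 𝓘(ℝ, E) x p ((extChartAt 𝓘(ℝ, E) x).symm z) := by
    have h1 := TangentBundle.symmL_trivializationAt_eq_core (I := 𝓘(ℝ, E)) hx'
    have h2 := TangentBundle.continuousLinearMapAt_trivializationAt_eq_core (I := 𝓘(ℝ, E)) hp'
    ext v
    have h3 := (tangentBundleCore 𝓘(ℝ, E) X).coordChange_comp (achart E x)
      (achart E ((extChartAt 𝓘(ℝ, E) x).symm z)) (achart E p) ((extChartAt 𝓘(ℝ, E) x).symm z)
      ⟨⟨hx', mem_chart_source E _⟩, hp'⟩ v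
    refine Eq.trans ?_ h3
    exact (DFunLike.congr_fun h2 _).trans (congrArg _ (DFunLike.congr_fun h1 v))
  rw [e]
  exact h

theorem jacobian_eventuallyEq {x p : X} {z : E} (hz : z ∈ overlap x p) :
    jacobian x p =ᶠ[𝓝 z] fderiv ℝ (transition x p) :=
  ((isOpen_overlap x p).eventually_mem hz).mono fun _ hw ↦ (hasFDerivAt_transition hw).fderiv.symm

theorem differentiableAt_jacobian {x p : X} {z : E} (hz : z ∈ overlap x p) :
    DifferentiableAt ℝ (jacobian x p) z :=
  (((contDiffAt_transition hz).fderiv_right (m := ∞) (by simp)).differentiableAt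
    (by simp)).congr_of_eventuallyEq (jacobian_eventuallyEq hz)

theorem jacobian_jacobian {x p : X} {z : E} (hz : z ∈ overlap x p) :
    jacobian p x (transition x p z) * jacobian x p z = 1 := by
  ext v
  change coframe x ((extChartAt 𝓘(ℝ, E) p).symm (transition x p z))
    (frame p ((extChartAt 𝓘(ℝ, E) p).symm (transition x p z))
      (coframe p ((extChartAt 𝓘(ℝ, E) x).symm z) (frame x ((extChartAt 𝓘(ℝ, E) x).symm z) v))) = v
  rw [transition_symm hz, frame_coframe (mem_chartAt_source_of_mem_overlap hz),
    coframe_frame (extChartAt_symm_mem_source hz.1)]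

theorem jacobian_jacobian' {x p : X} {z : E} (hz : z ∈ overlap x p) :
    jacobian x p z * jacobian p x (transition x p z) = 1 := by
  ext v
  change coframe p ((extChartAt 𝓘(ℝ, E) x).symm z) (frame x ((extChartAt 𝓘(ℝ, E) x).symm z)
    (coframe x ((extChartAt 𝓘(ℝ, E) p).symm (transition x p z))
      (frame p ((extChartAt 𝓘(ℝ, E) p).symm (transition x p z)) v))) = v
  rw [transition_symm hz, frame_coframe (extChartAt_symm_mem_source hz.1),
    coframe_frame (mem_chartAt_source_of_mem_overlap hz)]

theorem formInChart_transition (v : FormField (E := E) X) {x p : X} {z : E}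
    (hz : z ∈ overlap x p) (u w : E) :
    formInChart v x z u w =
      formInChart v p (transition x p z) (jacobian x p z u) (jacobian x p z w) := by
  have h (u : E) : frame p ((extChartAt 𝓘(ℝ, E) x).symm z) (jacobian x p z u) =
      frame x ((extChartAt 𝓘(ℝ, E) x).symm z) u :=
    frame_coframe (mem_chartAt_source_of_mem_overlap hz) _
  rw [formInChart_apply, formInChart_apply, transition_symm hz, h, h]

theorem endInChart_transition (A : EndField (E := E) X) {x p : X} {z : E}
    (hz : z ∈ overlap x p) :
    endInChart A x z =
      jacobian p x (transition x p z) * (endInChart A p (transition x p z) * jacobian x p z) := by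
  ext u
  have h1 : frame p ((extChartAt 𝓘(ℝ, E) x).symm z) (jacobian x p z u) =
      frame x ((extChartAt 𝓘(ℝ, E) x).symm z) u :=
    frame_coframe (mem_chartAt_source_of_mem_overlap hz) _
  change endInChart A x z u = coframe x ((extChartAt 𝓘(ℝ, E) p).symm (transition x p z))
    (frame p ((extChartAt 𝓘(ℝ, E) p).symm (transition x p z))
      (endInChart A p (transition x p z) (jacobian x p z u)))
  rw [endInChart_apply, endInChart_apply, transition_symm hz,
    frame_coframe (mem_chartAt_source_of_mem_overlap hz), h1]

end Transition

/-! ### The data of the family (g_t) in charts -/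

section Families

variable {E : Type*} [NormedAddCommGroup E] [NormedSpace ℝ E]
  {X : Type*} [TopologicalSpace X] [ChartedSpace E X] [IsManifold 𝓘(ℝ, E) ∞ X]

/-- The matrix of the metric `g_t` in the chart around `x`, as a function of `(t, y)`. -/
def metricInChart (g : ℝ → Metric (E := E) X) (x : X) (q : ℝ × E) : E →L[ℝ] E →L[ℝ] ℝ :=
  formInChart (g q.1).inner x q.2

/-- The endomorphism `ġ_t^*` in the chart around `x`, as a function of `(t, y)`. -/
def velocityInChart (g : ℝ → Metric (E := E) X) (x : X) (q : ℝ × E) : E →L[ℝ] E :=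
  endInChart (sharp (g q.1).inner (timeDeriv (fun s ↦ (g s).inner) q.1)) x q.2

/-- The Christoffel symbols of `g_t` in the chart around `x`, as a function of `(t, y)`. -/
def christoffelInChart (g : ℝ → Metric (E := E) X) (x : X) (q : ℝ × E) : E →L[ℝ] E →L[ℝ] E :=
  christoffel (fun z ↦ metricInChart g x (q.1, z)) q.2

variable {g : ℝ → Metric (E := E) X} {J : ℝ → EndField (E := E) X} {x : X}

theorem metricInChart_isInvertible [FiniteDimensional ℝ E] {q : ℝ × E}
    (hq : q ∈ Ici (0 : ℝ) ×ˢ (extChartAt 𝓘(ℝ, E) x).target) : (metricInChart g x q).IsInvertible :=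
  (g q.1).formInChart_isInvertible hq.2

theorem metricInChart_symm (q : ℝ × E) (v w : E) :
    metricInChart g x q v w = metricInChart g x q w v :=
  formInChart_symm (g q.1).symm x q.2 v w

theorem hasDerivWithinAt_metricInChart (hg : SmoothFormFamily (fun t ↦ (g t).inner)) {t : ℝ} {y : E}
    (ht : 0 ≤ t) (hy : y ∈ (extChartAt 𝓘(ℝ, E) x).target) :
    HasDerivWithinAt (fun s ↦ metricInChart g x (s, y))
      (formInChart (timeDeriv (fun s ↦ (g s).inner) t) x y) (Ici 0) t :=
  hasDerivWithinAt_formInChart hy ht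
    (hasDerivWithinAt_slice (((hg.contDiffOn x).differentiableOn (by simp)) (t, y)
      ⟨ht, hy⟩).hasFDerivWithinAt hy).differentiableWithinAt

theorem metricInChart_velocityInChart [FiniteDimensional ℝ E]
    (hg : SmoothFormFamily (fun t ↦ (g t).inner)) {q : ℝ × E}
    (hq : q ∈ Ici (0 : ℝ) ×ˢ (extChartAt 𝓘(ℝ, E) x).target) (v : E) :
    metricInChart g x q (velocityInChart g x q v) =
      derivWithin (fun s ↦ metricInChart g x (s, q.2)) (Ici 0) q.1 v := by
  rw [(hasDerivWithinAt_metricInChart hg hq.1 hq.2).derivWithin (uniqueDiffOn_Ici 0 q.1 hq.1)]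
  exact (g q.1).formInChart_sharp _ hq.2 v

theorem contDiffOn_velocityInChart [FiniteDimensional ℝ E]
    (hg : SmoothFormFamily (fun t ↦ (g t).inner)) (x : X) :
    ContDiffOn ℝ ∞ (velocityInChart g x) (Ici 0 ×ˢ (extChartAt 𝓘(ℝ, E) x).target) := by
  have : CompleteSpace E := FiniteDimensional.complete ℝ E
  have hG : ContDiffOn ℝ ∞ (metricInChart g x) _ := hg.contDiffOn x
  have h1 : ContDiffOn ℝ ∞ (fun q ↦ (metricInChart g x q).inverse)
      (Ici (0 : ℝ) ×ˢ (extChartAt 𝓘(ℝ, E) x).target) := fun q hq ↦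
    (metricInChart_isInvertible hq).contDiffAt_map_inverse.comp_contDiffWithinAt q (hG q hq)
  refine (h1.clm_comp
    (contDiffOn_derivWithin_slice (isOpen_extChartAt_target x) hG)).congr fun q hq ↦ ?_
  ext v
  change _ = (metricInChart g x q).inverse _
  exact ((metricInChart_isInvertible hq).inverse_apply_self _).symm.trans
    (congrArg _ (metricInChart_velocityInChart hg hq v))

theorem contDiffOn_christoffelInChart [FiniteDimensional ℝ E]
    (hg : SmoothFormFamily (fun t ↦ (g t).inner)) (x : X) :
    ContDiffOn ℝ ∞ (christoffelInChart g x) (Ici 0 ×ˢ (extChartAt 𝓘(ℝ, E) x).target) := by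
  have : CompleteSpace E := FiniteDimensional.complete ℝ E
  exact contDiffOn_christoffel (isOpen_extChartAt_target x) (hg.contDiffOn x)
    fun q hq ↦ metricInChart_isInvertible hq

theorem smoothForm_timeDeriv (hg : SmoothFormFamily (fun t ↦ (g t).inner)) {t : ℝ} (ht : 0 ≤ t) :
    SmoothForm (timeDeriv (fun s ↦ (g s).inner) t) := by
  refine smoothForm_iff.2 (smoothFormFamily_of_contDiffOn fun x ↦ ?_)
  have h := contDiffOn_derivWithin_slice (isOpen_extChartAt_target x) (hg.contDiffOn x)
  refine (h.comp (contDiffOn_const.prodMk contDiff_snd.contDiffOn)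
    (fun q hq ↦ ⟨ht, hq.2⟩)).congr (f := fun q : ℝ × E ↦ _) fun q hq ↦ ?_
  exact ((hasDerivWithinAt_metricInChart hg ht hq.2).derivWithin (uniqueDiffOn_Ici 0 t ht)).symm

theorem hasDerivWithinAt_inner (hg : SmoothFormFamily (fun t ↦ (g t).inner)) {t : ℝ} (ht : 0 ≤ t)
    (x : X) : HasDerivWithinAt (fun s ↦ metricInChart g x (s, extChartAt 𝓘(ℝ, E) x x))
      (timeDeriv (fun s ↦ (g s).inner) t x) (Ici 0) t := by
  have := hasDerivWithinAt_metricInChart hg ht (mem_extChartAt_target (I := 𝓘(ℝ, E)) x)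
  rwa [formInChart_self] at this

theorem timeDeriv_symm (hg : SmoothFormFamily (fun t ↦ (g t).inner)) {t : ℝ} (ht : 0 ≤ t)
    (x : X) (ξ η : Tan (E := E) X x) :
    timeDeriv (fun s ↦ (g s).inner) t x ξ η = timeDeriv (fun s ↦ (g s).inner) t x η ξ := by
  have c (a : E) : HasDerivWithinAt (fun _ : ℝ ↦ a) 0 (Ici 0) t := hasDerivWithinAt_const _ _ _
  let G' : E →L[ℝ] E →L[ℝ] ℝ := timeDeriv (fun s ↦ (g s).inner) t x
  have h0 : HasDerivWithinAt (fun s ↦ metricInChart g x (s, extChartAt 𝓘(ℝ, E) x x)) G' (Ici 0) t :=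
    hasDerivWithinAt_inner hg ht x
  have h (a b : E) := (h0.clm_apply (c a)).clm_apply (c b)
  have key (a b : E) : G' a b = G' b a := by
    have h2 := (h a b).congr_of_mem (fun s _ ↦ metricInChart_symm (s, _) b a) ht
    have h3 := (uniqueDiffOn_Ici 0 t ht).eq_deriv _ h2 (h b a)
    simp only [map_zero, add_zero] at h3
    exact h3
  exact key ξ η

end Families

/-! ### The 𝔻-condition at chart centres and its propagation -/

section Pointwise

variable {E : Type*} [NormedAddCommGroup E] [NormedSpace ℝ E]
  {X : Type*} [TopologicalSpace X] [ChartedSpace E X] [IsManifold 𝓘(ℝ, E) ∞ X]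
  {g : ℝ → Metric (E := E) X} {J : ℝ → EndField (E := E) X} {x : X} {t : ℝ}

theorem hasDerivWithinAt_endInChart_self (hJ : SolvesODE J g) (ht : 0 ≤ t) :
    HasDerivWithinAt (fun s ↦ endInChart (J s) x (extChartAt 𝓘(ℝ, E) x x))
      ((1 / 2 : ℝ) • (endInChart (J t) x (extChartAt 𝓘(ℝ, E) x x)
        * velocityInChart g x (t, extChartAt 𝓘(ℝ, E) x x)
        - velocityInChart g x (t, extChartAt 𝓘(ℝ, E) x x)
        * endInChart (J t) x (extChartAt 𝓘(ℝ, E) x x))) (Ici 0) t :=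
  hasDerivWithinAt_endInChart hJ (mem_extChartAt_target x) ht

theorem fderiv_endInChart_of_parallel {g : Metric (E := E) X} {J : EndField (E := E) X}
    (h : nabla g.inner J x = 0) :
    fderiv ℝ (endInChart J x) (extChartAt 𝓘(ℝ, E) x x) =
      commutatorForm (endInChart J x (extChartAt 𝓘(ℝ, E) x x))
        (christoffel (formInChart g.inner x) (extChartAt 𝓘(ℝ, E) x x)) := by
  rw [nabla_eq_covariantDeriv] at h
  exact sub_eq_zero.1 h

theorem contDiffOn_endInChart {A : EndField (E := E) X} (hA : SmoothEnd A) (x : X) :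
    ContDiffOn ℝ ∞ (endInChart A x) (extChartAt 𝓘(ℝ, E) x).target :=
  ((smoothEnd_iff.1 hA).contDiffOn x).comp (contDiffOn_const.prodMk contDiffOn_id)
    fun _ hz ↦ ⟨self_mem_Ici, hz⟩

theorem smoothEnd_of_smoothEndFamily (h : SmoothEndFamily J) (ht : 0 ≤ t) : SmoothEnd (J t) :=
  h.comp_contMDiff (contMDiff_const.prodMk contMDiff_id) fun _ ↦ ⟨ht, trivial⟩

variable [FiniteDimensional ℝ E]

/-- By nondegeneracy, equality with the transpose is tested against the metric. The data enter
through equations so that they can be matrices over E at the chart centre. -/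
theorem nabla01Contract_eq_transpose_iff (g : Metric (E := E) X) (J A : EndField (E := E) X)
    {a : E →L[ℝ] E} (ha : J x = a) {B : E →L[ℝ] E →L[ℝ] ℝ} (hB : g.inner x = B)
    {N : E →L[ℝ] E →L[ℝ] E} (hN : nabla g.inner A x = N) :
    (∀ ξ, nabla01Contract g.inner J A x ξ =
      transpose g.inner x (nabla01Contract g.inner J A x ξ)) ↔
    ∀ ξ v w, B ((1 / 2 : ℝ) • (N v ξ + a (N (a v) ξ))) w
        = B v ((1 / 2 : ℝ) • (N w ξ + a (N (a w) ξ))) := by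
  have hBi : B.IsInvertible := by
    have h := g.formInChart_isInvertible (mem_extChartAt_target (I := 𝓘(ℝ, E)) x)
    rwa [formInChart_self, hB] at h
  refine forall_congr' fun ξ ↦ ?_
  let M : E →L[ℝ] E := nabla01Contract g.inner J A x ξ
  let T : E →L[ℝ] E := transpose g.inner x (nabla01Contract g.inner J A x ξ)
  have hM (v : E) : M v = (1 / 2 : ℝ) • (N v ξ + a (N (a v) ξ)) := by
    subst ha hN
    rfl
  have hT (v w : E) : B (T v) w = B v (M w) := by
    subst hB
    exact g.inner_transpose x (nabla01Contract g.inner J A x ξ) v w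
  change M = T ↔ _
  simp only [← hM]
  constructor
  · intro h v w
    rw [← hT, ← h]
  · intro h
    ext v
    apply hBi.injective
    ext w
    rw [hT, h]

theorem continuousOn_velocityInChart (hg : SmoothFormFamily (fun t ↦ (g t).inner)) :
    ContinuousOn (fun s ↦ velocityInChart g x (s, extChartAt 𝓘(ℝ, E) x x)) (Ici 0) :=
  (contDiffOn_velocityInChart hg x).continuousOn.comp (by fun_prop)
    fun _ hs ↦ ⟨hs, mem_extChartAt_target x⟩

theorem endInChart_mul_self (hg : SmoothFormFamily (fun t ↦ (g t).inner)) (hJ : SolvesODE J g)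
    (h0 : IsKahler (J 0) (g 0)) (ht : 0 ≤ t) (x : X) :
    endInChart (J t) x (extChartAt 𝓘(ℝ, E) x x) * endInChart (J t) x (extChartAt 𝓘(ℝ, E) x x)
      = -1 := by
  refine mul_self_eq_neg_one_of_commutator_ode (continuousOn_velocityInChart hg)
    (fun r hr ↦ hasDerivWithinAt_endInChart_self hJ hr) ?_ ht
  rw [endInChart_self]
  exact h0.sq x

theorem metricInChart_antisymm (hg : SmoothFormFamily (fun t ↦ (g t).inner)) (hJ : SolvesODE J g)
    (h0 : IsKahler (J 0) (g 0)) (ht : 0 ≤ t) (x : X) (v w : E) :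
    metricInChart g x (t, extChartAt 𝓘(ℝ, E) x x)
        (endInChart (J t) x (extChartAt 𝓘(ℝ, E) x x) v) w =
      -metricInChart g x (t, extChartAt 𝓘(ℝ, E) x x) v
        (endInChart (J t) x (extChartAt 𝓘(ℝ, E) x x) w) := by
  have hmem := mem_extChartAt_target (I := 𝓘(ℝ, E)) x
  have hd (r : ℝ) (hr : 0 ≤ r) : HasDerivWithinAt _ _ (Ici 0) r :=
    hasDerivWithinAt_metricInChart hg hr hmem
  refine antisymm_of_commutator_ode (continuousOn_velocityInChart hg)
    (fun r hr ↦ hasDerivWithinAt_endInChart_self hJ hr) hd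
    (fun r hr ↦ metricInChart_symm _) (fun r hr v w ↦ ?_) (fun r hr v ↦ ?_) (fun v w ↦ ?_) ht v w
  · rw [formInChart_self]
    exact timeDeriv_symm hg hr x v w
  · rw [metricInChart_velocityInChart hg (q := (r, _)) ⟨hr, hmem⟩]
    exact congrArg (fun L : E →L[ℝ] E →L[ℝ] ℝ ↦ L v)
      ((hd r hr).derivWithin (uniqueDiffOn_Ici 0 r hr))
  · have hinv : ∀ v w, metricInChart g x (0, extChartAt 𝓘(ℝ, E) x x)
        (endInChart (J 0) x (extChartAt 𝓘(ℝ, E) x x) v)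
        (endInChart (J 0) x (extChartAt 𝓘(ℝ, E) x x) w)
        = metricInChart g x (0, extChartAt 𝓘(ℝ, E) x x) v w := by
      rw [endInChart_self, metricInChart, formInChart_self]
      exact h0.invariant x
    have hsq := DFunLike.congr_fun (endInChart_mul_self hg hJ h0 le_rfl x) v
    rw [← hinv (endInChart (J 0) x (extChartAt 𝓘(ℝ, E) x x) v) w]
    have hsq' : endInChart (J 0) x (extChartAt 𝓘(ℝ, E) x x)
      (endInChart (J 0) x (extChartAt 𝓘(ℝ, E) x x) v) = -v := hsq
    rw [hsq', map_neg, neg_apply]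

/-- The condition `ġ_t ∈ 𝔻` at a point, in terms of the variation of the connection. -/
theorem timeDeriv_mem_spaceD_iff (hg : SmoothFormFamily (fun t ↦ (g t).inner))
    (hJ : SolvesODE J g) (h0 : IsKahler (J 0) (g 0)) (ht : 0 ≤ t) :
    timeDeriv (fun s ↦ (g s).inner) t ∈ spaceD (J t) (g t) ↔
      ∀ x : X, commutatorForm (endInChart (J t) x (extChartAt 𝓘(ℝ, E) x x))
        (derivWithin (fun s ↦ christoffelInChart g x (s, extChartAt 𝓘(ℝ, E) x x)) (Ici 0) t) =
        (1 / 2 : ℝ) • commutatorForm (endInChart (J t) x (extChartAt 𝓘(ℝ, E) x x))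
          (fderiv ℝ (fun z ↦ velocityInChart g x (t, z)) (extChartAt 𝓘(ℝ, E) x x)
            - commutatorForm (velocityInChart g x (t, extChartAt 𝓘(ℝ, E) x x))
              (christoffelInChart g x (t, extChartAt 𝓘(ℝ, E) x x))) := by
  have : CompleteSpace E := FiniteDimensional.complete ℝ E
  -- Smoothness and symmetry of ġ_t come from the family, so only the transpose condition matters.
  have h1 : timeDeriv (fun s ↦ (g s).inner) t ∈ spaceD (J t) (g t) ↔
      ∀ (x : X) (ξ : Tan (E := E) X x), nabla01Contract (g t).inner (J t)
        (sharp (g t).inner (timeDeriv (fun s ↦ (g s).inner) t)) x ξ = transpose (g t).inner x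
          (nabla01Contract (g t).inner (J t)
            (sharp (g t).inner (timeDeriv (fun s ↦ (g s).inner) t)) x ξ) :=
    ⟨fun h ↦ h.2.2, fun h ↦ ⟨smoothForm_timeDeriv hg ht, timeDeriv_symm hg ht, h⟩⟩
  rw [h1]
  refine forall_congr' fun x ↦ ?_
  have hmem := mem_extChartAt_target (I := 𝓘(ℝ, E)) x
  have hq : (t, extChartAt 𝓘(ℝ, E) x x) ∈ Ici (0 : ℝ) ×ˢ (extChartAt 𝓘(ℝ, E) x).target := ⟨ht, hmem⟩
  rw [nabla01Contract_eq_transpose_iff (g t) (J t) _ (endInChart_self (J t) x).symm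
    (formInChart_self (g t).inner x).symm (nabla_eq_covariantDeriv _ _ x)]
  symm
  refine commutatorForm_eq_iff (metricInChart_isInvertible hq) (metricInChart_symm _)
    (fun v ↦ DFunLike.congr_fun (endInChart_mul_self hg hJ h0 ht x) v)
    (metricInChart_antisymm hg hJ h0 ht x) ?_
  exact derivWithin_christoffel (isOpen_extChartAt_target x) (hg.contDiffOn x)
    (fun q hq ↦ metricInChart_isInvertible hq) (fun q _ ↦ metricInChart_symm q)
    (contDiffOn_velocityInChart hg x) (fun q hq ↦ metricInChart_velocityInChart hg hq) ht hmem

theorem hasFDerivWithinAt_endInChart_self (hg : SmoothFormFamily (fun t ↦ (g t).inner))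
    (hJ : SolvesODE J g) (h0 : IsKahler (J 0) (g 0))
    (h : ∀ t, 0 ≤ t → timeDeriv (fun s ↦ (g s).inner) t ∈ spaceD (J t) (g t)) (ht : 0 ≤ t) (x : X) :
    HasFDerivWithinAt (fun q : ℝ × E ↦ endInChart (J q.1) x q.2)
      ((ContinuousLinearMap.fst ℝ ℝ E).smulRight
        ((1 / 2 : ℝ) • (endInChart (J t) x (extChartAt 𝓘(ℝ, E) x x)
          * velocityInChart g x (t, extChartAt 𝓘(ℝ, E) x x)
          - velocityInChart g x (t, extChartAt 𝓘(ℝ, E) x x)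
          * endInChart (J t) x (extChartAt 𝓘(ℝ, E) x x)))
        + commutatorForm (endInChart (J t) x (extChartAt 𝓘(ℝ, E) x x))
          (christoffelInChart g x (t, extChartAt 𝓘(ℝ, E) x x)) ∘L ContinuousLinearMap.snd ℝ ℝ E)
      (Ici 0 ×ˢ (extChartAt 𝓘(ℝ, E) x).target) (t, extChartAt 𝓘(ℝ, E) x x) := by
  have hmem := mem_extChartAt_target (I := 𝓘(ℝ, E)) x
  refine hasFDerivWithinAt_of_commutatorForm_derivWithin
    (J := fun q : ℝ × E ↦ endInChart (J q.1) x q.2) (isOpen_extChartAt_target x)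
    (contDiffOn_christoffelInChart hg x) (contDiffOn_velocityInChart hg x) hmem
    (fun s hs z hz ↦ hasDerivWithinAt_endInChart hJ hz hs) ?_
    (fun s hs ↦ (timeDeriv_mem_spaceD_iff hg hJ h0 hs).1 (h s hs) x) ht
  have h1 := ((contDiffOn_endInChart h0.smooth x).contDiffAt
    ((isOpen_extChartAt_target x).mem_nhds hmem)).differentiableAt (by simp)
  exact h1.hasFDerivAt.congr_fderiv (fderiv_endInChart_of_parallel (h0.parallel x))

/-- A point y of the chart around x is the centre of the chart around p, where the formula is known;
the coordinate change from x to p brings it back to y. -/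
theorem hasFDerivWithinAt_endInChart (hg : SmoothFormFamily (fun t ↦ (g t).inner))
    (hJ : SolvesODE J g) (h0 : IsKahler (J 0) (g 0))
    (h : ∀ t, 0 ≤ t → timeDeriv (fun s ↦ (g s).inner) t ∈ spaceD (J t) (g t)) (x : X) {q : ℝ × E}
    (hq : q ∈ Ici (0 : ℝ) ×ˢ (extChartAt 𝓘(ℝ, E) x).target) :
    HasFDerivWithinAt (fun q : ℝ × E ↦ endInChart (J q.1) x q.2)
      ((ContinuousLinearMap.fst ℝ ℝ E).smulRight
        ((1 / 2 : ℝ) • (endInChart (J q.1) x q.2 * velocityInChart g x q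
          - velocityInChart g x q * endInChart (J q.1) x q.2))
        + commutatorForm (endInChart (J q.1) x q.2) (christoffelInChart g x q)
          ∘L ContinuousLinearMap.snd ℝ ℝ E)
      (Ici 0 ×ˢ (extChartAt 𝓘(ℝ, E) x).target) q := by
  obtain ⟨t, y⟩ := q
  obtain ⟨ht, hy⟩ : 0 ≤ t ∧ y ∈ (extChartAt 𝓘(ℝ, E) x).target := hq
  set p := (extChartAt 𝓘(ℝ, E) x).symm y with hp
  have hyW : y ∈ overlap x p := ⟨hy, mem_extChartAt_source p⟩
  have hτ : transition x p y = extChartAt 𝓘(ℝ, E) p p := rfl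
  have hmem := mem_extChartAt_target (I := 𝓘(ℝ, E)) p
  have hself := hasFDerivWithinAt_endInChart_self hg hJ h0 h ht p
  rw [← hτ] at hself hmem
  have hq₁ : (t, y) ∈ Ici (0 : ℝ) ×ˢ (extChartAt 𝓘(ℝ, E) x).target := ⟨ht, hy⟩
  have hq₂ : (t, transition x p y) ∈ Ici (0 : ℝ) ×ˢ (extChartAt 𝓘(ℝ, E) p).target := ⟨ht, hmem⟩
  have hΓ (u : E) : jacobian x p y * christoffelInChart g x (t, y) u =
      christoffelInChart g p (t, transition x p y) (jacobian x p y u) * jacobian x p y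
        + fderiv ℝ (jacobian x p) y u := by
    ext v
    refine christoffel_change (G₁ := fun z ↦ metricInChart g x (t, z))
      (G₂ := fun z ↦ metricInChart g p (t, z)) (τ := transition x p) (φ := jacobian x p)
      (ψ := fun z ↦ jacobian p x (transition x p z))
      (contDiffAt_transition hyW) (jacobian_eventuallyEq hyW)
      (fun u ↦ DFunLike.congr_fun (jacobian_jacobian' hyW) u)
      (metricInChart_isInvertible hq₁) (metricInChart_isInvertible hq₂) ?_
      (.of_forall fun z ↦ metricInChart_symm _) ?_ u v
    · exact (hasFDerivAt_slice (isOpen_extChartAt_target p)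
        (((hg.contDiffOn p).differentiableOn (by simp)) _ hq₂).hasFDerivWithinAt
        ht hmem).differentiableAt
    · exact ((isOpen_overlap x p).eventually_mem hyW).mono
        fun z hz ↦ formInChart_transition (g t).inner hz
  have key := hasFDerivWithinAt_change (J₁ := fun q : ℝ × E ↦ endInChart (J q.1) x q.2)
    (ψ := fun z ↦ jacobian p x (transition x p z)) ht (isOpen_overlap x p) hyW
    (fun z hz ↦ (transition_mem_overlap hz).1) (hasFDerivAt_transition hyW)
    (differentiableAt_jacobian hyW)
    ((differentiableAt_jacobian (transition_mem_overlap hyW)).comp y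
      (hasFDerivAt_transition hyW).differentiableAt)
    (fun z hz ↦ jacobian_jacobian hz) (fun z hz ↦ jacobian_jacobian' hz) hΓ
    (fun s z hz ↦ endInChart_transition (J s) hz) (hasDerivWithinAt_endInChart hJ hy ht) hself
  refine key.mono_of_mem_nhdsWithin ?_
  rw [nhdsWithin_prod_eq]
  exact Filter.prod_mem_prod self_mem_nhdsWithin
    (mem_nhdsWithin_of_mem_nhds ((isOpen_overlap x p).mem_nhds hyW))

theorem smoothEndFamily_of_mem_spaceD (hg : SmoothFormFamily (fun t ↦ (g t).inner))
    (hJ : SolvesODE J g) (h0 : IsKahler (J 0) (g 0))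
    (h : ∀ t, 0 ≤ t → timeDeriv (fun s ↦ (g s).inner) t ∈ spaceD (J t) (g t)) :
    SmoothEndFamily J :=
  smoothEndFamily_of_contDiffOn fun x ↦ contDiffOn_of_hasFDerivWithinAt_commutator
    (isOpen_extChartAt_target x) (contDiffOn_christoffelInChart hg x)
    (contDiffOn_velocityInChart hg x) fun _ hq ↦ hasFDerivWithinAt_endInChart hg hJ h0 h x hq

theorem isKahler_of_mem_spaceD (hg : SmoothFormFamily (fun t ↦ (g t).inner))
    (hJ : SolvesODE J g) (h0 : IsKahler (J 0) (g 0))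
    (h : ∀ t, 0 ≤ t → timeDeriv (fun s ↦ (g s).inner) t ∈ spaceD (J t) (g t)) (ht : 0 ≤ t) :
    IsKahler (J t) (g t) where
  smooth := smoothEnd_of_smoothEndFamily (smoothEndFamily_of_mem_spaceD hg hJ h0 h) ht
  sq x := by
    have h1 := endInChart_mul_self hg hJ h0 ht x
    rw [endInChart_self] at h1
    exact h1
  invariant x ξ η := by
    have h1 := endInChart_mul_self hg hJ h0 ht x
    have h2 := metricInChart_antisymm hg hJ h0 ht x
    simp only [metricInChart, formInChart_self] at h2
    rw [endInChart_self] at h1 h2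
    let a : E →L[ℝ] E := J t x
    let B : E →L[ℝ] E →L[ℝ] ℝ := (g t).inner x
    have h3 (v : E) : a (a v) = -v := DFunLike.congr_fun h1 v
    have h4 (v w : E) : B (a v) (a w) = B v w := by
      have h5 : B (a v) (a w) = -B v (a (a w)) := h2 v (a w)
      rw [h5, h3, map_neg, neg_neg]
    exact h4 ξ η
  parallel x := by
    rw [nabla_eq_covariantDeriv]
    refine sub_eq_zero.2 ?_
    have h1 := (hasFDerivAt_slice (isOpen_extChartAt_target x)
      (hasFDerivWithinAt_endInChart_self hg hJ h0 h ht x) ht (mem_extChartAt_target x)).fderiv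
    refine Eq.trans h1 ?_
    ext u v
    simp
    rfl

end Pointwise

end KahlerVariation
end

/-! ### The equivalence -/

theorem mainTheorem6 {E : Type*} [NormedAddCommGroup E] [NormedSpace ℝ E] [FiniteDimensional ℝ E]
    {X : Type*} [TopologicalSpace X] [ChartedSpace E X] [IsManifold 𝓘(ℝ, E) ∞ X]
    (g : ℝ → KahlerVariation.Metric (E := E) X)
    (hg : KahlerVariation.SmoothFormFamily (fun t ↦ (g t).inner))
    (J : ℝ → KahlerVariation.EndField (E := E) X)
    (hJ : KahlerVariation.SolvesODE J g)
    (h0 : KahlerVariation.IsKahler (J 0) (g 0)) :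
    KahlerVariation.IsSmoothKahlerFamily J g ↔
      ∀ t, 0 ≤ t →
        KahlerVariation.timeDeriv (fun s ↦ (g s).inner) t ∈
          KahlerVariation.spaceD (J t) (g t) := by
  constructor
  · intro h t ht
    refine (KahlerVariation.timeDeriv_mem_spaceD_iff hg hJ h0 ht).2 fun x ↦ ?_
    exact KahlerVariation.commutatorForm_derivWithin_of_fderiv_eq
      (Γ := KahlerVariation.christoffelInChart g x) (S := KahlerVariation.velocityInChart g x)
      (J := fun q : ℝ × E ↦ KahlerVariation.endInChart (J q.1) x q.2) (isOpen_extChartAt_target x)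
      (KahlerVariation.contDiffOn_christoffelInChart hg x)
      (KahlerVariation.contDiffOn_velocityInChart hg x) (h.smooth_J.contDiffOn x)
      (mem_extChartAt_target x)
      (fun s hs z hz ↦ KahlerVariation.hasDerivWithinAt_endInChart hJ hz hs)
      (fun s hs ↦ KahlerVariation.fderiv_endInChart_of_parallel ((h.kahler s hs).parallel x)) ht
  · intro h
    exact ⟨KahlerVariation.smoothEndFamily_of_mem_spaceD hg hJ h0 h, hg,
      fun t ht ↦ KahlerVariation.isKahler_of_mem_spaceD hg hJ h0 h ht⟩
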